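/- **Theorem (NPMembershipTheorem).** A unit square layout is a finite family of pairwise disjoint closed axis-parallel unit squares $(R_v)_{v\in V}$ in the plane; the position of a square is its lower left corner. Two distinct squares $R_u,R_v$ see each other if there is a closed axis-parallel rectangle $S$ of positive width and height such that one side of $S$ is contained in $R_u$, the opposite side of $S$ is contained in $R_v$, and $S$ is disjoint from every other square of the layout. The layout represents the graph $(V,\{\{u,v\} : u\neq v,\ R_u \text{ and } R_v \text{ see each other}\})$. Let $\mathsf{USV}$ be the class of finite graphs represented by some unit square layout, and $\mathsf{USGV}$ the class of those represented by some unit square layout in which all positions lie in $\mathbb{N}\times\mathbb{N}$. The recognition problem of a class of graphs is the language of all encodings of graphs of the class, where a graph with vertices $1,\dots,n$ is encoded by $1^n0$ followed by its $n\times n$ adjacency matrix, row by row. Then: 1. The recognition problem of $\mathsf{USV}$ is in $\mathsf{NP}$: its instances have polynomial-size certificates that are checked by a Turing machine in polynomial time. 2. Every graph $G\in\mathsf{USV}$ with $n$ vertices is represented by a unit square layout in which both coordinates of every position belong to $\{\frac an : a\in\mathbb{Z},\ 0\le a\le n^2\}$. 3. The recognition problem of $\mathsf{USGV}$ is in $\mathsf{NP}$.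 4. Every graph $G\in\mathsf{USGV}$ with $n$ vertices is represented by a unit square layout in which both coordinates of every position are integers between $0$ and $2n-1$. -/

import Mathlib

namespace UnitSquareVisibility

/-- The closed axis-parallel unit square whose lower left corner (its position) is `p`. -/
def unitSquare (p : ℝ × ℝ) : Set (ℝ × ℝ) :=
  Set.Icc p.1 (p.1 + 1) ×ˢ Set.Icc p.2 (p.2 + 1)

/-- `R i` sees `R j` from the left: there is a closed non-degenerate rectangle
`S = [a, b] × [c, d]` whose left side lies in `R i`, whose right side lies in `R j`, and which
is disjoint from all other members of the family. -/
def SeesFromLeft {V : Type*} (R : V → Set (ℝ × ℝ)) (i j : V) : Prop :=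
  ∃ a b c d : ℝ, a < b ∧ c < d ∧
    ({a} : Set ℝ) ×ˢ Set.Icc c d ⊆ R i ∧
    ({b} : Set ℝ) ×ˢ Set.Icc c d ⊆ R j ∧
    ∀ k, k ≠ i → k ≠ j → (Set.Icc a b ×ˢ Set.Icc c d) ∩ R k = ∅

/-- `R i` sees `R j` from above: there is a closed non-degenerate rectangle
`S = [a, b] × [c, d]` whose upper side lies in `R i`, whose lower side lies in `R j`, and which
is disjoint from all other members of the family. -/
def SeesFromAbove {V : Type*} (R : V → Set (ℝ × ℝ)) (i j : V) : Prop :=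
  ∃ a b c d : ℝ, a < b ∧ c < d ∧
    Set.Icc a b ×ˢ ({d} : Set ℝ) ⊆ R i ∧
    Set.Icc a b ×ˢ ({c} : Set ℝ) ⊆ R j ∧
    ∀ k, k ≠ i → k ≠ j → (Set.Icc a b ×ˢ Set.Icc c d) ∩ R k = ∅

/-- The (simple, undirected) graph represented by a family of rectangles: distinct `i` and `j`
are adjacent iff one of `R i`, `R j` sees the other horizontally or vertically. -/
def visibilityGraph {V : Type*} (R : V → Set (ℝ × ℝ)) : SimpleGraph V where
  Adj i j := i ≠ j ∧
    ((SeesFromLeft R i j ∨ SeesFromLeft R j i) ∨ (SeesFromAbove R i j ∨ SeesFromAbove R j i))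
  symm := ⟨fun _ _ h => ⟨h.1.symm, h.2.imp Or.symm Or.symm⟩⟩
  loopless := ⟨fun _ h => h.1 rfl⟩

/-- The unit squares at the positions `p v` are pairwise disjoint, hence form a unit square
layout, and this layout represents `G`, the square at `p v` being that of the vertex `v`. -/
def Represents {V : Type*} (p : V → ℝ × ℝ) (G : SimpleGraph V) : Prop :=
  (∀ u v, u ≠ v → Disjoint (unitSquare (p u)) (unitSquare (p v))) ∧
    visibilityGraph (fun v => unitSquare (p v)) = G

/-- The position in the plane given by a pair of natural numbers. -/
def gridPosition (q : ℕ × ℕ) : ℝ × ℝ := ((q.1 : ℝ), (q.2 : ℝ))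

/-- `G` is a unit square visibility graph. -/
def IsUSV {V : Type*} (G : SimpleGraph V) : Prop :=
  ∃ p : V → ℝ × ℝ, Represents p G

/-- `G` is a unit square grid visibility graph. -/
def IsUSGV {V : Type*} (G : SimpleGraph V) : Prop :=
  ∃ q : V → ℕ × ℕ, Represents (fun v => gridPosition (q v)) G

/-! ### Recognition problems and the class NP -/

open Classical in
/-- Encoding of a graph on `n` vertices as a binary string: `n` in unary, a separator, and the
`n * n` entries of the adjacency matrix row by row. -/
noncomputable def encodeGraph {n : ℕ} (G : SimpleGraph (Fin n)) : List Bool :=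
  List.replicate n true ++ false ::
    (List.ofFn fun i : Fin n => List.ofFn fun j : Fin n => decide (G.Adj i j)).flatten

/-- The recognition problem for a class of finite graphs, as a language: the set of all
encodings of members of the class (strings that encode no graph are no-instances). -/
def recognitionProblem (𝒢 : ∀ n : ℕ, SimpleGraph (Fin n) → Prop) : Language Bool :=
  {w | ∃ (n : ℕ) (G : SimpleGraph (Fin n)), 𝒢 n G ∧ w = encodeGraph G}

/-- Encoding of an (instance, certificate) pair of binary strings, with a separator symbol. -/
def encodePair (z : List Bool × List Bool) : List (Option Bool) :=
  z.1.map some ++ none :: z.2.map some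

/-- The class NP: there are a polynomial `q` and a predicate `f` decided by a Turing machine in
time polynomial in its input length, such that `x ∈ L` iff `f` accepts `(x, w)` for some
certificate `w` of length at most `q(|x|)`. -/
def InNP (L : Language Bool) : Prop :=
  ∃ (q : Polynomial ℕ) (f : List Bool × List Bool → Bool),
    Nonempty (Turing.TM2ComputableInPolyTime encodePair Computability.encodeBool f) ∧
    ∀ x : List Bool, x ∈ L ↔ ∃ w : List Bool, w.length ≤ q.eval x.length ∧ f (x, w) = true

end UnitSquareVisibility

/-!
Visibility between squares only depends on the order of the endpoints of their projections to the
two axes (`SameOrder`). Indeed, one square sees another from the left if and only if they are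
suitably placed and some thin horizontal strip between them is free; its lower border can be moved
down to the next endpoint of a projection (`represents_iff`, `isLayout_iff`). It therefore suffices
to change each of the two families of coordinates without changing the order of the endpoints.

*Small coordinates.* Keeping the integral parts and replacing the `n` fractional parts by their
ranks turns real coordinates into multiples of `1 / n` (`exists_sameOrder_nat`). Measuring in the
unit `1 / D`, where `D = n`, or `D = 1` on the grid, consider a solution in natural numbers with
minimal sum. It has no gaps larger than `D + 1`, as these could be shrunk, so the coordinates are
at most `(D + 1) * (n - 1)` (`exists_sameOrder_small`).

*Membership in NP.* The certificate is a table of bits listing these small coordinates. That a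
string consists of the encoding of a graph and such a table for a layout of this graph can be said
in first-order logic, with variables ranging over the positions in the string and atomic formulas
comparing quadratic polynomials in the variables and reading letters (`Verifier.accepts`). Each
fixed formula of this kind can be checked by a Turing machine in polynomial time (`Fml.polyTime`):
the values of the variables are kept in unary on stacks, quantifiers are loops, and truth values are computed
on one more stack. The machine is obtained by compiling a small structured language of stack
programs (`Prog.Exec.simulates`).
-/

namespace UnitSquareVisibility

/-! ### A structured language of stack programs -/

/-- The alphabet of the working stacks, which is that of `encodePair`. -/
abbrev Sym := Option Bool

/-- Structured programs working on stacks named by `S`. There is no state besides the stacks: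
the popped symbol is only available for branching. -/
inductive Prog (S : Type) : Type
  | skip : Prog S
  | push (k : S) (a : Sym) : Prog S
  | seq (p q : Prog S) : Prog S
  /-- Pop stack `k` (a no-op on an empty stack) and continue according to the symbol found. -/
  | case (k : S) (f : Option Sym → Prog S) : Prog S
  /-- Pop stack `k` and run `f` on the symbol found, until the stack is empty. -/
  | loop (k : S) (f : Sym → Prog S) : Prog S

namespace Prog

variable {S : Type}

/-- Control points of a program, used as labels of the compiled machine. -/
def Lab : Prog S → Type
  | skip => Unit
  | push _ _ => Unit
  | seq p q => Lab p ⊕ Lab q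
  | case _ f => Option (Σ o, Lab (f o))
  | loop _ f => Option (Σ a, Lab (f a))

theorem finite_lab : ∀ p : Prog S, Finite (Lab p)
  | skip => inferInstanceAs (Finite Unit)
  | push _ _ => inferInstanceAs (Finite Unit)
  | seq p q => by
    have := finite_lab p
    have := finite_lab q
    exact inferInstanceAs (Finite (Lab p ⊕ Lab q))
  | case _ f => by
    have := fun o => finite_lab (f o)
    exact inferInstanceAs (Finite (Option (Σ o, Lab (f o))))
  | loop _ f => by
    have := fun o => finite_lab (f o)
    exact inferInstanceAs (Finite (Option (Σ o, Lab (f o))))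

/-- The control point at which a program starts. -/
def entry : (p : Prog S) → Lab p
  | skip => ()
  | push _ _ => ()
  | seq p _ => Sum.inl (entry p)
  | case _ _ => (none : Option _)
  | loop _ _ => (none : Option _)

/-- Stack alphabets of the compiled machine: `none` names the Boolean output stack. -/
abbrev StackAlphabet (S : Type) : Option S → Type
  | none => Bool
  | some _ => Sym

/-- The statement of the compiled machine at a control point of `p`, where `emb` embeds the
control points of `p` into the labels of the machine and `ex` is the label to jump to in the end.
The internal state of the machine holds the last popped symbol. -/
def code {Λ : Type} : (p : Prog S) → (Lab p → Λ) → Λ → Lab p →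
    Turing.TM2.Stmt (StackAlphabet S) Λ (Option Sym)
  | skip, _, ex, _ => .goto fun _ => ex
  | push k a, _, ex, _ => .push (some k) (fun _ => a) (.goto fun _ => ex)
  | seq p q, emb, _, Sum.inl l =>
      code p (fun l => emb (Sum.inl l)) (emb (Sum.inr (entry q))) l
  | seq _ q, emb, ex, Sum.inr l => code q (fun l => emb (Sum.inr l)) ex l
  | case k f, emb, _, none =>
      .pop (some k) (fun _ o => o) (.goto fun o => emb (some ⟨o, entry (f o)⟩))
  | case _ f, emb, ex, some ⟨o, l⟩ => code (f o) (fun l => emb (some ⟨o, l⟩)) ex l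
  | loop k f, emb, ex, none =>
      .pop (some k) (fun _ o => o)
        (.goto fun o => o.elim ex fun a => emb (some ⟨a, entry (f a)⟩))
  | loop _ f, emb, _, some ⟨a, l⟩ => code (f a) (fun l => emb (some ⟨a, l⟩)) (emb none) l

variable [DecidableEq S]

/-- `Exec p st t st'`: started on the stacks `st`, the program `p` terminates with the stacks
`st'`, and the compiled machine needs `t` steps for this. -/
inductive Exec : Prog S → (S → List Sym) → ℕ → (S → List Sym) → Prop
  | skip (st) : Exec skip st 1 st
  | push (k a st) : Exec (push k a) st 1 (Function.update st k (a :: st k))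
  | seq {p q st t st' t' st''} : Exec p st t st' → Exec q st' t' st'' →
      Exec (seq p q) st (t + t') st''
  | case {k f st t st'} : Exec (f (st k).head?) (Function.update st k (st k).tail) t st' →
      Exec (case k f) st (t + 1) st'
  | loop_nil {k f st} : st k = [] → Exec (loop k f) st 1 st
  | loop_cons {k f st a l t st' t' st''} : st k = a :: l →
      Exec (f a) (Function.update st k l) t st' → Exec (loop k f) st' t' st'' →
      Exec (loop k f) st (t + t' + 1) st''

/-- The stacks of the compiled machine, for a given output stack and given working stacks. -/
def liftStacks (o : List Bool) (st : S → List Sym) : ∀ k : Option S, List (StackAlphabet S k)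
  | none => o
  | some k => st k

theorem update_liftStacks (o : List Bool) (st : S → List Sym) (k : S) (l : List Sym) :
    Function.update (liftStacks o st) (some k) l = liftStacks o (Function.update st k l) := by
  funext j
  rcases j with _ | j
  · rfl
  · by_cases h : j = k
    · subst h
      refine (Function.update_self (β := fun k => List (StackAlphabet S k)) _ _ _).trans ?_
      exact (Function.update_self (β := fun _ => List Sym) j l st).symm
    · refine (Function.update_of_ne (β := fun k => List (StackAlphabet S k))
        (by simpa using h) _ _).trans ?_
      exact (Function.update_of_ne (β := fun _ => List Sym) h l st).symm

theorem update_liftStacks_none (o o' : List Bool) (st : S → List Sym) :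
    Function.update (liftStacks o st) none o' = liftStacks o' st := by
  funext j
  rcases j with _ | j
  · exact Function.update_self (β := fun k => List (StackAlphabet S k)) _ _ _
  · exact Function.update_of_ne (β := fun k => List (StackAlphabet S k)) (by simp) _ _

theorem iterate_bind_succ {α : Type*} (f : α → Option α) (a : α) (b : Option α) (t : ℕ)
    (c : α) (h : f a = some c) (ht : (flip bind f)^[t] (some c) = b) :
    (flip bind f)^[t + 1] (some a) = b := by
  rw [Function.iterate_succ_apply]
  have : flip bind f (some a) = some c := h
  rw [this, ht]

/-- The compiled code simulates the program within any machine containing it: execution ends at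
the label `ex`. The internal state is not tracked, as no statement reads it before a pop. -/
theorem Exec.simulates {Λ : Type} (M : Λ → Turing.TM2.Stmt (StackAlphabet S) Λ (Option Sym))
    {p : Prog S} {st : S → List Sym} {t : ℕ} {st' : S → List Sym} (h : Exec p st t st') :
    ∀ (emb : Lab p → Λ) (ex : Λ), (∀ l, M (emb l) = code p emb ex l) → ∀ v, ∃ v',
      (flip bind (Turing.TM2.step M))^[t]
        (some ⟨some (emb (entry p)), v, liftStacks [] st⟩) =
          some ⟨some ex, v', liftStacks [] st'⟩ := by
  induction h with
  | skip st =>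
    intro emb ex hM v
    refine ⟨v, iterate_bind_succ _ _ _ 0 _ ?_ rfl⟩
    simp [Turing.TM2.step, hM, code]
  | push k a st =>
    intro emb ex hM v
    refine ⟨v, iterate_bind_succ _ _ _ 0 _ ?_ rfl⟩
    simp only [Turing.TM2.step, hM, code, Turing.TM2.stepAux]
    rw [← update_liftStacks]
    rfl
  | @seq p q st t st' t' st'' h₁ h₂ ih₁ ih₂ =>
    intro emb ex hM v
    obtain ⟨v₁, e₁⟩ := ih₁ (fun l => emb (Sum.inl l)) (emb (Sum.inr (entry q)))
      (fun l => (hM (Sum.inl l)).trans (by rw [code])) v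
    obtain ⟨v₂, e₂⟩ := ih₂ (fun l => emb (Sum.inr l)) ex
      (fun l => (hM (Sum.inr l)).trans (by rw [code])) v₁
    refine ⟨v₂, ?_⟩
    rw [add_comm, Function.iterate_add_apply]
    exact (congrArg _ e₁).trans e₂
  | @case k f st t st' h ih =>
    intro emb ex hM v
    obtain ⟨v₁, e₁⟩ := ih (fun l => emb (some ⟨_, l⟩)) ex
      (fun l => (hM (some ⟨_, l⟩)).trans (by rw [code])) (st k).head?
    refine ⟨v₁, iterate_bind_succ _ _ _ _ _ ?_ e₁⟩
    have hM' := hM none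
    rw [code] at hM'
    rw [← update_liftStacks]
    simp only [entry, Turing.TM2.step, hM', Turing.TM2.stepAux]
    rfl
  | @loop_nil k f st h =>
    intro emb ex hM v
    refine ⟨none, iterate_bind_succ _ _ _ 0 _ ?_ rfl⟩
    have hM' := hM none
    rw [code] at hM'
    have e : Function.update (liftStacks [] st) (some k) (liftStacks [] st (some k)).tail =
        liftStacks [] st := by
      rw [show (liftStacks [] st (some k)).tail = liftStacks [] st (some k) by
        change (st k).tail = st k
        rw [h]
        rfl]
      exact Function.update_eq_self _ _
    simp only [entry, Turing.TM2.step, hM', Turing.TM2.stepAux]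
    rw [e]
    simp only [liftStacks, h]
    rfl
  | @loop_cons k f st a l t st' t' st'' hk h₁ h₂ ih₁ ih₂ =>
    intro emb ex hM v
    obtain ⟨v₁, e₁⟩ := ih₁ (fun l => emb (some ⟨_, l⟩)) (emb none)
      (fun l => (hM (some ⟨_, l⟩)).trans (by rw [code])) (some a)
    obtain ⟨v₂, e₂⟩ := ih₂ emb ex hM v₁
    refine ⟨v₂, iterate_bind_succ _ _ _ (t + t')
      ⟨some (emb (some ⟨a, entry (f a)⟩)), some a, liftStacks [] (Function.update st k l)⟩ ?_ ?_⟩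
    · have hM' := hM none
      rw [code] at hM'
      rw [← update_liftStacks]
      simp only [entry, Turing.TM2.step, hM', Turing.TM2.stepAux]
      simp only [liftStacks, hk]
      rfl
    · rw [add_comm, Function.iterate_add_apply]
      exact (congrArg _ e₁).trans e₂

/-- The last statement of the compiled machine: output whether the top of stack `k` is
`some true`, removing this symbol, and reset the internal state. -/
def outputStmt (k : S) (Λ : Type) : Turing.TM2.Stmt (StackAlphabet S) Λ (Option Sym) :=
  .pop (some k) (fun _ o => o)
    (.push none (fun o => decide (o = some (some true))) (.load (fun _ => none) .halt))

theorem stepAux_outputStmt (k : S) (Λ : Type) (v : Option Sym) (st : S → List Sym) (b : Bool)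
    (l : List Sym) (h : st k = some b :: l) :
    Turing.TM2.stepAux (outputStmt k Λ) v (liftStacks [] st) =
      ⟨none, none, liftStacks [b] (Function.update st k l)⟩ := by
  have e : liftStacks [] st (some k) = some b :: l := h
  simp only [outputStmt, Turing.TM2.stepAux]
  rw [e, update_liftStacks, List.tail_cons, update_liftStacks_none]
  cases b <;> rfl

end Prog

open Prog

/-- The machine that runs `p` on the input on stack `k₀` and then executes `outputStmt k₁`. -/
noncomputable def machine {S : Type} [DecidableEq S] [Fintype S] (p : Prog S) (k₀ k₁ : S) :
    Turing.FinTM2 where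
  K := Option S
  k₀ := some k₀
  k₁ := none
  Γ := StackAlphabet S
  Λ := Option (Lab p)
  main := some (entry p)
  ΛFin := have := finite_lab p; Fintype.ofFinite _
  σ := Option Sym
  initialState := none
  Γk₀Fin := inferInstanceAs (Fintype Sym)
  m l := match l with
    | some l => code p some none l
    | none => outputStmt k₁ _

theorem initList_machine {S : Type} [DecidableEq S] [Fintype S] (p : Prog S) (k₀ k₁ : S)
    (l : List Sym) :
    Turing.initList (machine p k₀ k₁) l =
      ⟨some (some (entry p)), none, liftStacks [] (Function.update (fun _ => []) k₀ l)⟩ := by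
  unfold Turing.initList
  congr 1
  funext k
  rcases k with _ | k
  · exact dif_neg (by simp [machine])
  · by_cases hk : k = k₀
    · subst hk
      refine (dif_pos rfl).trans ?_
      change l = Function.update (fun _ => []) k l k
      exact (Function.update_self (β := fun _ => List Sym) k l _).symm
    · refine (dif_neg (by simpa [machine] using hk)).trans ?_
      exact (Function.update_of_ne (β := fun _ => List Sym) hk l fun _ => []).symm

theorem haltList_machine {S : Type} [DecidableEq S] [Fintype S] (p : Prog S) (k₀ k₁ : S)
    (o : List Bool) :
    Turing.haltList (machine p k₀ k₁) o = ⟨none, none, liftStacks o fun _ => []⟩ := by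
  unfold Turing.haltList
  congr 1
  funext k
  rcases k with _ | k
  · exact dif_pos rfl
  · exact dif_neg (by simp [machine])

/-- A Boolean function is computable in polynomial time if a stack program, started with the
input on one of its stacks, leaves nothing but the result, in polynomial time. -/
theorem polyTime_of_exec {S : Type} [DecidableEq S] [Fintype S] {α : Type}
    (enc : α → List Sym) (f : α → Bool) (p : Prog S) (k₀ k₁ : S) (T : Polynomial ℕ)
    (h : ∀ a, ∃ t ≤ T.eval (enc a).length, Exec p (Function.update (fun _ => []) k₀ (enc a)) t
      (Function.update (fun _ => []) k₁ [some (f a)])) :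
    Nonempty (Turing.TM2ComputableInPolyTime enc Computability.encodeBool f) := by
  refine ⟨{ tm := machine p k₀ k₁, inputAlphabet := Equiv.refl Sym,
            outputAlphabet := Equiv.refl Bool, time := T + 1, outputsFun := fun a => ?_ }⟩
  have h' := h a
  refine ⟨⟨h'.choose + 1, ?_⟩, ?_⟩
  swap
  · simpa using h'.choose_spec.1
  obtain ⟨v, hv⟩ := h'.choose_spec.2.simulates (machine p k₀ k₁).m some none (fun l => rfl) none
  have hi : Turing.initList (machine p k₀ k₁) (List.map (Equiv.refl Sym).invFun (enc a)) = _ :=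
    (congrArg _ (List.map_id _)).trans (initList_machine p k₀ k₁ (enc a))
  have hf : Turing.haltList (machine p k₀ k₁) (List.map (Equiv.refl Bool).invFun [f a]) = _ :=
    haltList_machine p k₀ k₁ [f a]
  rw [Function.iterate_succ_apply', hi]
  refine (congrArg (flip bind _) hv).trans ?_
  refine Eq.trans ?_ (congrArg some hf).symm
  refine congrArg some ((stepAux_outputStmt k₁ _ v _ (f a) []
    (Function.update_self (β := fun _ => List Sym) k₁ _ _)).trans ?_)
  rw [Function.update_idem, Function.update_eq_self_iff.2 rfl]
  rfl

/-! ### Running times of basic programs -/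

namespace Prog

variable {S : Type} [DecidableEq S]

/-- Started on the stacks `st`, the program `p` terminates within `T` steps with stacks `st'`. -/
def Runs (p : Prog S) (st : S → List Sym) (T : ℕ) (st' : S → List Sym) : Prop :=
  ∃ t ≤ T, Exec p st t st'

theorem Runs.of_le {p : Prog S} {st st' : S → List Sym} {T T' : ℕ} (h : Runs p st T st')
    (hT : T ≤ T') : Runs p st T' st' :=
  let ⟨t, ht, e⟩ := h
  ⟨t, ht.trans hT, e⟩

theorem Runs.congr {p : Prog S} {st st' st₁ st₁' : S → List Sym} {T : ℕ} (h : Runs p st T st')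
    (e : st = st₁) (e' : st' = st₁') : Runs p st₁ T st₁' := e ▸ e' ▸ h

theorem runs_skip (st : S → List Sym) : Runs skip st 1 st := ⟨1, le_rfl, .skip st⟩

theorem runs_push (k : S) (a : Sym) (st : S → List Sym) :
    Runs (push k a) st 1 (Function.update st k (a :: st k)) := ⟨1, le_rfl, .push k a st⟩

theorem Runs.seq {p q : Prog S} {st st' st'' : S → List Sym} {T T' : ℕ} (h : Runs p st T st')
    (h' : Runs q st' T' st'') : Runs (Prog.seq p q) st (T + T') st'' :=
  let ⟨t, ht, e⟩ := h
  let ⟨t', ht', e'⟩ := h'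
  ⟨t + t', add_le_add ht ht', .seq e e'⟩

theorem Runs.case {k : S} {f : Option Sym → Prog S} {st st' : S → List Sym} {T : ℕ}
    (h : Runs (f (st k).head?) (Function.update st k (st k).tail) T st') :
    Runs (Prog.case k f) st (T + 1) st' :=
  let ⟨t, ht, e⟩ := h
  ⟨t + 1, Nat.succ_le_succ ht, .case e⟩

/-- A loop over a stack of `n` symbols, where `St j` are the stacks when `j` symbols are left. -/
theorem runs_loop {k : S} {f : Sym → Prog S} {T : ℕ} (St : ℕ → S → List Sym)
    (h0 : St 0 k = []) : ∀ n, (∀ j < n, ∃ a l, St (j + 1) k = a :: l ∧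
      Runs (f a) (Function.update (St (j + 1)) k l) T (St j)) →
    Runs (loop k f) (St n) (n * (T + 1) + 1) (St 0)
  | 0, _ => ⟨1, by simp, .loop_nil h0⟩
  | n + 1, h => by
    obtain ⟨a, l, e, t, ht, hr⟩ := h n n.lt_succ_self
    obtain ⟨t', ht', hr'⟩ := runs_loop St h0 n fun j hj => h j (hj.trans n.lt_succ_self)
    exact ⟨t + t' + 1, by linarith, .loop_cons e hr hr'⟩

/-- The stack content representing the number `n`. -/
def unary (n : ℕ) : List Sym := List.replicate n none

theorem unary_succ (n : ℕ) : unary (n + 1) = none :: unary n := rfl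

theorem unary_add (m n : ℕ) : unary (m + n) = unary m ++ unary n :=
  List.replicate_add ..

theorem runs_clear (k : S) (st : S → List Sym) :
    Runs (loop k fun _ => skip) st ((st k).length * 2 + 1) (Function.update st k []) := by
  have := runs_loop (k := k) (f := fun _ => skip) (T := 1)
    (fun j => Function.update st k ((st k).drop ((st k).length - j))) (by simp) (st k).length
    (fun j hj => by
      refine ⟨(st k)[(st k).length - (j + 1)], (st k).drop ((st k).length - j), ?_, ?_⟩
      · rw [Function.update_self, List.drop_eq_getElem_cons (by omega)]
        congr 2
        omega
      · simpa using runs_skip _)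
  simpa using this

/-- Add the number on stack `k` to that on stack `b`, with the help of the empty stack `s`. -/
def addTo (s k b : S) : Prog S :=
  .seq (loop k fun _ => push s none) (loop s fun _ => .seq (push k none) (push b none))

theorem runs_addTo {s k b : S} (hks : k ≠ s) (hkb : k ≠ b) (hsb : s ≠ b) (st : S → List Sym)
    (n N : ℕ) (hn : n ≤ N) (hk : st k = unary n) (hs : st s = []) :
    Runs (addTo s k b) st (5 * N + 2) (Function.update st b (unary n ++ st b)) := by
  have h₁ := runs_loop (k := k) (f := fun _ => push s none) (T := 1)
    (fun j => Function.update (Function.update st k (unary j)) s (unary (n - j)))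
    (by simp [hks, unary]) n
    (fun j hj => by
      refine ⟨none, unary j, by simp [hks, unary_succ], (runs_push _ _ _).congr rfl ?_⟩
      have e : n - j = n - (j + 1) + 1 := by omega
      funext x
      by_cases hx : x = s
      · subst hx
        simp [hks.symm, e, unary_succ]
      · simp only [Function.update_apply, hx, if_false]
        split_ifs <;> rfl)
  have h₂ := runs_loop (k := s) (f := fun _ => .seq (push k none) (push b none)) (T := 2)
    (fun j => Function.update (Function.update (Function.update st s (unary j)) k
      (unary (n - j))) b (unary (n - j) ++ st b))
    (by simp [hks.symm, hsb, unary]) n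
    (fun j hj => by
      refine ⟨none, unary j, by simp [hks.symm, hsb, unary_succ],
        ((runs_push _ _ _).seq (runs_push _ _ _)).congr rfl ?_⟩
      have e : n - j = n - (j + 1) + 1 := by omega
      funext x
      by_cases hx : x = b
      · subst hx
        simp [hkb.symm, hsb.symm, e, unary_succ]
      · by_cases hx' : x = k
        · subst hx'
          simp [hkb, hks, e, unary_succ]
        · simp only [Function.update_apply, hx, hx', if_false]
          split_ifs <;> rfl)
  refine ((h₁.congr ?_ rfl).seq (h₂.congr ?_ ?_)).of_le (by omega)
  all_goals
    funext x
    simp only [Function.update_apply, Nat.sub_self, Nat.sub_zero]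
    split_ifs <;> simp_all [unary]

end Prog

open Prog

/-! ### Bounded arithmetic formulas about strings -/

/-- Arithmetic terms in variables from `ι`. -/
inductive Term (ι : Type) : Type
  | one : Term ι
  | var (i : ι) : Term ι
  | mul (i j : ι) : Term ι
  | add (t u : Term ι) : Term ι

/-- First-order formulas about a string: the variables range over its positions, and the atomic
formulas compare terms, and positions given by terms with letters. -/
inductive Fml (ι : Type) : Type
  | letter (a : Sym) (t : Term ι) : Fml ι
  | le (t u : Term ι) : Fml ι
  | not (φ : Fml ι) : Fml ι
  | and (φ ψ : Fml ι) : Fml ι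
  | ex (i : ι) (φ : Fml ι) : Fml ι

variable {ι : Type}

/-- The value of a term. -/
def Term.val (e : ι → ℕ) : Term ι → ℕ
  | one => 1
  | var i => e i
  | mul i j => e i * e j
  | add t u => t.val e + u.val e

/-- Satisfaction of a formula by the string `s` and the assignment `e`. -/
def Fml.Holds [DecidableEq ι] (s : List Sym) (e : ι → ℕ) : Fml ι → Prop
  | letter a t => s[t.val e]? = some a
  | le t u => t.val e ≤ u.val e
  | not φ => ¬ φ.Holds s e
  | and φ ψ => φ.Holds s e ∧ ψ.Holds s e
  | ex i φ => ∃ n < s.length, φ.Holds s (Function.update e i n)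

/-- The variable `i` is quantified somewhere in the formula. -/
def Fml.Binds (i : ι) : Fml ι → Prop
  | letter _ _ => False
  | le _ _ => False
  | not φ => φ.Binds i
  | and φ ψ => φ.Binds i ∨ ψ.Binds i
  | ex j φ => i = j ∨ φ.Binds i

/-- No variable is quantified within the scope of a quantifier for the same variable. -/
def Fml.WellScoped : Fml ι → Prop
  | letter _ _ => True
  | le _ _ => True
  | not φ => φ.WellScoped
  | and φ ψ => φ.WellScoped ∧ ψ.WellScoped
  | ex i φ => ¬ φ.Binds i ∧ φ.WellScoped

/-! ### Model checking in polynomial time -/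

/-- The stacks used for model checking: the string `inp`, split into `tmp` and `inp` while a
position is looked up, its length `len`, the values `acc₁` and `acc₂` of terms, the counters `cnt`
and `sav`, truth values `vals`, and the values of the variables. -/
inductive Stk (ι : Type) : Type
  | inp | tmp | len | acc₁ | acc₂ | cnt | sav | vals
  | reg (i : ι)
  deriving DecidableEq, Fintype

/-- The program pushing the value of a term onto stack `b`. -/
def Term.prog [DecidableEq ι] (b : Stk ι) : Term ι → Prog (Stk ι)
  | one => .push b none
  | var i => addTo .sav (.reg i) b
  | mul i j => .seq (addTo .sav (.reg i) .cnt) (.loop .cnt fun _ => addTo .sav (.reg j) b)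
  | add t u => .seq (t.prog b) (u.prog b)

/-- The program pushing the truth value of a formula onto stack `vals`. A quantified variable must
be `0` before, and is `0` again afterwards. -/
def Fml.prog [DecidableEq ι] : Fml ι → Prog (Stk ι)
  | letter a t =>
    .seq (t.prog .acc₁) <|
    .seq (.loop .acc₁ fun _ => .case .inp fun o => o.elim .skip fun c => .push .tmp c) <|
    .seq (.case .inp fun o => o.elim (.push .vals (some false)) fun c =>
      .seq (.push .inp c) (.push .vals (some (decide (c = a))))) <|
    .loop .tmp fun c => .push .inp c
  | le t u =>
    .seq (t.prog .acc₁) <|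
    .seq (u.prog .acc₂) <|
    .seq (.loop .acc₂ fun _ => .case .acc₁ fun _ => .skip) <|
    .seq (.case .acc₁ fun o => .push .vals (some o.isNone)) <|
    .loop .acc₁ fun _ => .skip
  | not φ => .seq φ.prog (.case .vals fun o => .push .vals (some (o ≠ some (some true))))
  | and φ ψ => .seq φ.prog <| .seq ψ.prog <|
      .case .vals fun o => if o = some (some true) then .skip else
        .case .vals fun _ => .push .vals (some false)
  | ex i φ => .seq (addTo .sav .len (.reg i)) <| .seq (.push .vals (some false)) <|
      .loop (.reg i) fun _ => .seq φ.prog <|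
        .case .vals fun o => if o = some (some true) then
          .case .vals fun _ => .push .vals (some true) else .skip

/-- The stacks `st` hold the string `s` and the assignment `e`, and are otherwise empty, with the
possible exception of `vals`. -/
structure Ready (s : List Sym) (e : ι → ℕ) (st : Stk ι → List Sym) : Prop where
  inp : st .inp = s
  tmp : st .tmp = []
  len : st .len = unary s.length
  acc₁ : st .acc₁ = []
  acc₂ : st .acc₂ = []
  cnt : st .cnt = []
  sav : st .sav = []
  reg : ∀ i, st (.reg i) = unary (e i)

theorem Ready.vals [DecidableEq ι] {s : List Sym} {e : ι → ℕ} {st : Stk ι → List Sym}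
    (h : Ready s e st) (l : List Sym) : Ready s e (Function.update st .vals l) := by
  obtain ⟨h1, h2, h3, h4, h5, h6, h7, h8⟩ := h
  constructor <;> simpa

/-- A bound for the running time of `Term.prog`, in terms of a bound for the variables. -/
noncomputable def Term.time : Term ι → Polynomial ℕ
  | one => 1
  | var _ => 5 * .X + 2
  | mul _ _ => 5 * .X + 2 + (.X * (5 * .X + 3) + 1)
  | add t u => t.time + u.time

/-- A bound for the value of a term, in terms of a bound for the variables. -/
noncomputable def Term.bound : Term ι → Polynomial ℕ
  | one => 1
  | var _ => .X
  | mul _ _ => .X * .X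
  | add t u => t.bound + u.bound

/-- A bound for the running time of `Fml.prog`, in terms of the length of the string. -/
noncomputable def Fml.time : Fml ι → Polynomial ℕ
  | letter _ t => t.time + (t.bound * 3 + 1 + (3 + (.X * 2 + 1)))
  | le t u => t.time + (u.time + (u.bound * 3 + 1 + (2 + (t.bound * 2 + 1))))
  | not φ => φ.time + 2
  | and φ ψ => φ.time + (ψ.time + 3)
  | ex _ φ => 5 * .X + 2 + (1 + (.X * (φ.time + 3 + 1) + 1))

theorem Term.val_le (t : Term ι) (e : ι → ℕ) (N : ℕ) (he : ∀ i, e i ≤ N) :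
    t.val e ≤ t.bound.eval N := by
  induction t with
  | one => simp [val, bound]
  | var i => simpa [val, bound] using he i
  | mul i j => simpa [val, bound] using Nat.mul_le_mul (he i) (he j)
  | add t u iht ihu => simpa [val, bound] using add_le_add iht ihu

theorem Term.runs_prog [DecidableEq ι] {b : Stk ι} (hb : b = .acc₁ ∨ b = .acc₂) (t : Term ι)
    (e : ι → ℕ) (N : ℕ) (he : ∀ i, e i ≤ N) (st : Stk ι → List Sym) (hc : st .cnt = [])
    (hs : st .sav = []) (hr : ∀ i, st (.reg i) = unary (e i)) :
    Runs (t.prog b) st (t.time.eval N) (Function.update st b (unary (t.val e) ++ st b)) := by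
  have hbc : b ≠ .cnt := by rcases hb with rfl | rfl <;> simp
  have hbs : b ≠ .sav := by rcases hb with rfl | rfl <;> simp
  have hbr : ∀ i, b ≠ .reg i := by rcases hb with rfl | rfl <;> simp
  induction t generalizing st with
  | one => exact (runs_push _ _ _).of_le (by simp [time])
  | var i =>
    refine Runs.of_le (T := 5 * N + 2) ?_ (by simp [time])
    exact runs_addTo (by simp) (hbr i).symm hbs.symm st (e i) N (he i) (hr i) hs
  | mul i j =>
    have h₁ := runs_addTo (k := .reg i) (b := .cnt) (s := .sav) (by simp) (by simp) (by simp)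
      st (e i) N (he i) (hr i) hs
    have h₂ := runs_loop (k := .cnt) (f := fun _ => addTo .sav (.reg j) b) (T := 5 * N + 2)
      (fun n => Function.update (Function.update st .cnt (unary n)) b
        (unary ((e i - n) * e j) ++ st b)) (by simp [hbc.symm, unary]) (e i) (fun n hn => by
          refine ⟨none, unary n, by simp [hbc.symm, unary_succ], ?_⟩
          refine (runs_addTo (by simp) (hbr j).symm hbs.symm _ (e j) N (he j) ?_ ?_).congr rfl ?_
          · simp [(hbr j).symm, hr]
          · simp [hbs.symm, hs]
          · have e' : e i - n = e i - (n + 1) + 1 := by omega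
            funext x
            by_cases hx : x = b
            · subst hx
              simp [hbc, e', Nat.succ_mul, Nat.add_comm _ (e j), unary_add]
            · simp only [Function.update_apply, hx, if_false]
              split_ifs <;> rfl)
    refine ((h₁.seq (h₂.congr ?_ ?_))).of_le ?_
    · funext x
      simp only [Function.update_apply, Nat.sub_self]
      split_ifs <;> simp_all [unary]
    · funext x
      simp only [Function.update_apply, Nat.sub_zero, val]
      split_ifs <;> simp_all [unary]
    · have := Nat.mul_le_mul_right (5 * N + 3) (he i)
      simp only [time, Polynomial.eval_add, Polynomial.eval_mul, Polynomial.eval_ofNat,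
        Polynomial.eval_X, Polynomial.eval_one]
      rw [show 5 * N + 2 + 1 = 5 * N + 3 from rfl]
      omega
  | add t u iht ihu =>
    have h₁ := iht st hc hs hr
    have h₂ := ihu (Function.update st b (unary (t.val e) ++ st b))
      (by simpa [hbc.symm] using hc) (by simpa [hbs.symm] using hs)
      (fun i => by simpa [(hbr i).symm] using hr i)
    refine ((h₁.seq h₂).of_le (by simp [time])).congr rfl ?_
    simp [val, Nat.add_comm (t.val e), unary_add]

theorem reverse_take_succ {α : Type} {l : List α} {c : ℕ} (h : c < l.length) :
    (l.take (c + 1)).reverse = l[c] :: (l.take c).reverse := by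
  rw [List.take_succ_eq_append_getElem h, List.reverse_append]
  rfl

theorem runs_pour {S : Type} [DecidableEq S] {k b : S} (hkb : k ≠ b) (st : S → List Sym) :
    Runs (loop k fun c => push b c) st ((st k).length * 2 + 1)
      (Function.update (Function.update st k []) b ((st k).reverse ++ st b)) := by
  have := runs_loop (k := k) (f := fun c => push b c) (T := 1)
    (fun j => Function.update (Function.update st k ((st k).drop ((st k).length - j))) b
      (((st k).take ((st k).length - j)).reverse ++ st b)) (by simp [hkb]) (st k).length
    (fun j hj => by
      obtain ⟨c, hc, hc', hlt⟩ : ∃ c, (st k).length - (j + 1) = c ∧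
        (st k).length - j = c + 1 ∧ c < (st k).length := ⟨_, rfl, by omega, by omega⟩
      simp only [hc, hc']
      refine ⟨(st k)[c], (st k).drop (c + 1), ?_, (runs_push _ _ _).congr rfl ?_⟩
      · rw [Function.update_of_ne hkb, Function.update_self, List.drop_eq_getElem_cons hlt]
      · funext x
        by_cases hx : x = b
        · subst hx
          simp [hkb.symm, reverse_take_succ hlt]
        · simp only [Function.update_apply, hx, if_false]
          split_ifs <;> rfl)
  refine this.congr ?_ ?_
  · funext x
    simp only [Function.update_apply, Nat.sub_self]
    split_ifs <;> simp_all
  · simp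

/-- While `acc₁` is emptied, the string is moved from `inp` to `tmp`, up to the position looked up;
a position beyond the end of the string leaves `inp` empty. -/
theorem Fml.runs_prog_letter [DecidableEq ι] (a : Sym) (t : Term ι) (s : List Sym) (e : ι → ℕ)
    (he : ∀ i, e i ≤ s.length) (st : Stk ι → List Sym) (h : Ready s e st) :
    Runs (letter a t).prog st ((letter a t).time.eval s.length)
      (Function.update st .vals (some (decide (s[t.val e]? = some a)) :: st .vals)) := by
  obtain ⟨hinp, htmp, hlen, hacc₁, hacc₂, hcnt, hsav, hreg⟩ := h
  have h₁ := t.runs_prog (Or.inl rfl) e _ he st hcnt hsav hreg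
  set v := t.val e with hv
  have h₂ := runs_loop (k := .acc₁)
    (f := fun _ => .case .inp fun o => o.elim .skip fun c => .push .tmp c) (T := 2)
    (fun j => Function.update (Function.update (Function.update st .acc₁ (unary j)) .inp
      (s.drop (v - j))) .tmp (s.take (v - j)).reverse) (by simp [unary]) v (fun j hj => by
      obtain ⟨c, hc, hc'⟩ : ∃ c, v - (j + 1) = c ∧ v - j = c + 1 := ⟨_, rfl, by omega⟩
      simp only [hc, hc']
      refine ⟨none, unary j, by simp [unary_succ], .case ?_⟩
      by_cases hlt : c < s.length
      · have hh : (s.drop c).head? = some s[c] := by simp [hlt]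
        simp only [ne_eq, reduceCtorEq, not_false_eq_true, Function.update_of_ne,
          Function.update_self, hh, Option.elim_some]
        refine (runs_push _ _ _).congr rfl ?_
        funext x
        rcases x with _ | _ | _ | _ | _ | _ | _ | _ | i <;>
          simp [reverse_take_succ hlt, List.tail_drop]
      · have hh : s.drop c = [] := by simpa using hlt
        simp only [ne_eq, reduceCtorEq, not_false_eq_true, Function.update_of_ne,
          Function.update_self, hh, List.head?_nil, Option.elim_none]
        refine (runs_skip _).congr rfl ?_
        rw [List.take_of_length_le (by omega : s.length ≤ c),
          List.take_of_length_le (by omega : s.length ≤ c + 1),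
          List.drop_of_length_le (by omega : s.length ≤ c + 1)]
        funext x
        rcases x with _ | _ | _ | _ | _ | _ | _ | _ | i <;> simp)
  have h₃ : Runs (.case .inp fun o => o.elim (.push .vals (some false)) fun c =>
      .seq (.push .inp c) (.push .vals (some (decide (c = a)))))
      (Function.update (Function.update st .inp (s.drop v)) .tmp (s.take v).reverse) 3
      (Function.update (Function.update (Function.update st .inp (s.drop v)) .tmp
        (s.take v).reverse) .vals (some (decide (s[v]? = some a)) :: st .vals)) := by
    refine .case ?_
    by_cases hlt : v < s.length
    · have hh : (s.drop v).head? = some s[v] := by simp [hlt]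
      simp only [ne_eq, reduceCtorEq, not_false_eq_true, Function.update_of_ne,
        Function.update_self, hh, Option.elim_some]
      refine ((runs_push _ _ _).seq (runs_push _ _ _)).congr rfl ?_
      funext x
      rcases x with _ | _ | _ | _ | _ | _ | _ | _ | i <;>
        simp [List.tail_drop, hlt]
    · have hh : s.drop v = [] := by simpa using hlt
      simp only [ne_eq, reduceCtorEq, not_false_eq_true, Function.update_of_ne,
        Function.update_self, hh, List.head?_nil, Option.elim_none]
      refine ((runs_push _ _ _).of_le (by simp)).congr rfl ?_
      funext x
      have hn : s[v]? = none := by simpa using hlt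
      rcases x with _ | _ | _ | _ | _ | _ | _ | _ | i <;> simp [hn]
  have h₄ := runs_pour (k := .tmp) (b := .inp) (by simp)
    (Function.update (Function.update (Function.update st .inp (s.drop v)) .tmp
        (s.take v).reverse) .vals (some (decide (s[v]? = some a)) :: st .vals))
  refine ((h₁.seq ((h₂.congr ?_ ?_).seq (h₃.seq h₄))).of_le ?_).congr rfl ?_
  · funext x
    rcases x with _ | _ | _ | _ | _ | _ | _ | _ | i <;> simp [*]
  · funext x
    rcases x with _ | _ | _ | _ | _ | _ | _ | _ | i <;> simp [unary, *]
  · have := t.val_le e _ he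
    simp [time]
    omega
  · funext x
    rcases x with _ | _ | _ | _ | _ | _ | _ | _ | i <;> simp [*]

/-- While `acc₂` is emptied, `acc₁` is decremented, so that the truncated difference of the two
values remains on `acc₁`. -/
theorem Fml.runs_prog_le [DecidableEq ι] (t u : Term ι) (s : List Sym) (e : ι → ℕ)
    (he : ∀ i, e i ≤ s.length) (st : Stk ι → List Sym) (h : Ready s e st) :
    Runs (le t u).prog st ((le t u).time.eval s.length)
      (Function.update st .vals (some (decide (t.val e ≤ u.val e)) :: st .vals)) := by
  obtain ⟨hinp, htmp, hlen, hacc₁, hacc₂, hcnt, hsav, hreg⟩ := h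
  have h₁ := t.runs_prog (Or.inl rfl) e _ he st hcnt hsav hreg
  have h₂ := u.runs_prog (Or.inr rfl) e _ he
    (Function.update st .acc₁ (unary (t.val e) ++ st .acc₁)) (by simpa) (by simpa) (by simpa)
  have hv := t.val_le e _ he
  have hw := u.val_le e _ he
  set v := t.val e
  set w := u.val e
  have h₃ := runs_loop (k := .acc₂)
    (f := fun _ => .case .acc₁ fun _ => .skip) (T := 2)
    (fun j => Function.update (Function.update st .acc₁ (unary (v - (w - j)))) .acc₂ (unary j))
    (by simp [unary]) w (fun j hj => by
      refine ⟨none, unary j, by simp [unary_succ], .case ((runs_skip _).congr rfl ?_)⟩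
      funext x
      have e' : v - (w - j) = v - (w - (j + 1)) - 1 := by omega
      rcases x with _ | _ | _ | _ | _ | _ | _ | _ | i <;> simp [e', unary])
  have h₄ : Runs (.case .acc₁ fun o => .push .vals (some o.isNone))
      (Function.update st .acc₁ (unary (v - w))) 2
      (Function.update (Function.update st .acc₁ (unary (v - w - 1))) .vals
        (some (decide (v ≤ w)) :: st .vals)) := by
    refine .case ((runs_push _ _ _).congr rfl ?_)
    funext x
    rcases x with _ | _ | _ | _ | _ | _ | _ | _ | i <;> simp [unary]
    by_cases hle : v ≤ w
    · simp [hle]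
    · obtain ⟨m, hm⟩ : ∃ m, v - w = m + 1 := ⟨v - w - 1, by omega⟩
      simp [hle, hm, List.replicate_succ]
  have h₅ := runs_clear .acc₁ (Function.update (Function.update st .acc₁ (unary (v - w - 1)))
    .vals (some (decide (v ≤ w)) :: st .vals))
  refine ((h₁.seq (h₂.seq ((h₃.congr ?_ ?_).seq (h₄.seq h₅)))).of_le ?_).congr rfl ?_
  · funext x
    rcases x with _ | _ | _ | _ | _ | _ | _ | _ | i <;> simp [*]
  · funext x
    rcases x with _ | _ | _ | _ | _ | _ | _ | _ | i <;> simp [unary, *]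
  · simp [time, unary]
    omega
  · funext x
    rcases x with _ | _ | _ | _ | _ | _ | _ | _ | i <;> simp [*]

open Classical in
/-- The model checking program computes the truth value of a formula, provided that the
quantified variables have been cleared. -/
theorem Fml.runs_prog [DecidableEq ι] (φ : Fml ι) (hφ : φ.WellScoped) (s : List Sym)
    (e : ι → ℕ) (he : ∀ i, e i ≤ s.length) (hb : ∀ i, φ.Binds i → e i = 0)
    (st : Stk ι → List Sym) (h : Ready s e st) :
    Runs φ.prog st (φ.time.eval s.length)
      (Function.update st .vals (some (decide (φ.Holds s e)) :: st .vals)) := by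
  induction φ generalizing e st with
  | letter a t =>
    convert runs_prog_letter a t s e he st h
    exact Iff.rfl
  | le t u =>
    convert runs_prog_le t u s e he st h
    exact Iff.rfl
  | not φ ih =>
    have h₁ := ih hφ e he hb st h
    refine ((h₁.seq (.case (runs_push _ _ _))).of_le (by simp [time])).congr rfl ?_
    by_cases hh : φ.Holds s e <;> simp [Holds, hh]
  | and φ ψ ihφ ihψ =>
    have h₁ := ihφ hφ.1 e he (fun i hi => hb i (.inl hi)) st h
    have h₂ := ihψ hφ.2 e he (fun i hi => hb i (.inr hi)) _
      (h.vals (some (decide (φ.Holds s e)) :: st .vals))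
    refine (h₁.seq (h₂.seq (T' := 3) (.case ?_))).of_le (by simp [time])
    by_cases hψ : ψ.Holds s e
    · simp only [hψ, decide_true, Function.update_self, List.head?_cons, if_true, List.tail_cons,
        Function.update_idem]
      refine ((runs_skip _).of_le (by simp)).congr rfl ?_
      simp [Holds, hψ]
    · simp only [hψ, decide_false, Function.update_self, List.head?_cons, List.tail_cons,
        Function.update_idem]
      refine Runs.case ((runs_push _ _ _).congr rfl ?_)
      simp [Holds, hψ]
  | ex i φ ih =>
    -- The variable runs through all positions in decreasing order. When `j` is the content of its
    -- stack, the top of `vals` tells whether a position that is at least `j` is a witness.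
    have h₁ := runs_addTo (s := .sav) (k := .len) (b := .reg i) (by simp) (by simp) (by simp) st
      s.length s.length le_rfl h.len h.sav
    have h₂ := runs_push .vals (some false)
      (Function.update st (.reg i) (unary s.length ++ st (.reg i)))
    have h₃ := runs_loop (k := .reg i) (T := φ.time.eval s.length + 3) (f := fun _ => .seq φ.prog <|
        .case .vals fun o => if o = some (some true) then
          .case .vals fun _ => .push .vals (some true) else .skip)
      (fun j => Function.update (Function.update st (.reg i) (unary j)) .vals
        (some (decide (∃ n < s.length, j ≤ n ∧ φ.Holds s (Function.update e i n))) :: st .vals))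
      (by simp [unary]) s.length (fun j hj => by
        refine ⟨none, unary j, by simp [unary_succ], ?_⟩
        have e₁ : Function.update (Function.update (Function.update st (.reg i) (unary (j + 1)))
          .vals (some (decide (∃ n < s.length, j + 1 ≤ n ∧
            φ.Holds s (Function.update e i n))) :: st .vals)) (.reg i) (unary j) =
            Function.update (Function.update st (.reg i) (unary j))
              .vals (some (decide (∃ n < s.length, j + 1 ≤ n ∧
                φ.Holds s (Function.update e i n))) :: st .vals) := by
          rw [Function.update_comm (by simp), Function.update_idem]
        rw [e₁]
        have h₄ := ih hφ.2 (Function.update e i j) (fun k => by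
            by_cases hk : k = i
            · subst hk; simpa using hj.le
            · simpa [hk] using he k)
          (fun k hk => by
            have : k ≠ i := by rintro rfl; exact hφ.1 hk
            simpa [this] using hb k (.inr hk))
          (Function.update (Function.update st (.reg i) (unary j))
              .vals (some (decide (∃ n < s.length, j + 1 ≤ n ∧
                φ.Holds s (Function.update e i n))) :: st .vals)) (Ready.vals (by
            obtain ⟨h1, h2, h3, h4, h5, h6, h7, h8⟩ := h
            constructor
            case reg =>
              intro k
              by_cases hk : k = i
              · subst hk; simp
              · simp [hk, h8]
            all_goals simpa) _)
        refine h₄.seq (.case ?_)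
        have e₂ : (∃ n < s.length, j ≤ n ∧ φ.Holds s (Function.update e i n)) ↔
            φ.Holds s (Function.update e i j) ∨
              ∃ n < s.length, j + 1 ≤ n ∧ φ.Holds s (Function.update e i n) := by
          constructor
          · rintro ⟨n, hn, hjn, hh⟩
            rcases hjn.eq_or_lt with rfl | hlt
            · exact .inl hh
            · exact .inr ⟨n, hn, hlt, hh⟩
          · rintro (hh | ⟨n, hn, hjn, hh⟩)
            · exact ⟨j, hj, le_rfl, hh⟩
            · exact ⟨n, hn, by omega, hh⟩
        by_cases hh : φ.Holds s (Function.update e i j)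
        · simp only [hh, decide_true, Function.update_self, List.head?_cons, if_true,
            List.tail_cons, Function.update_idem]
          refine Runs.case ((runs_push _ _ _).congr rfl ?_)
          simp [e₂, hh]
        · simp only [hh, decide_false, Function.update_self, List.head?_cons, List.tail_cons,
            Function.update_idem]
          refine ((runs_skip _).of_le (by simp)).congr rfl ?_
          simp [e₂, hh])
    have hi : st (.reg i) = [] := by rw [h.reg, hb i (.inl rfl)]; rfl
    refine ((h₁.seq (h₂.seq (h₃.congr ?_ rfl))).of_le (by simp [time])).congr rfl ?_
    · have : ¬ ∃ n < s.length, s.length ≤ n ∧ φ.Holds s (Function.update e i n) := by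
        rintro ⟨n, hn, hn', _⟩
        omega
      simp [this, hi]
    · have : Function.update st (.reg i) (unary 0) = st := by
        exact Function.update_eq_self_iff.2 hi.symm
      simp only [this, Holds, Nat.zero_le, true_and]
      congr!
      exact decide_eq_decide.2 Iff.rfl

/-- Model checking of a closed formula, on the stacks of a machine. -/
def Fml.check [DecidableEq ι] (φ : Fml ι) : Prog (Stk ι) :=
  .seq (.loop .inp fun c => .seq (.push .tmp c) (.push .len none)) <|
  .seq (.loop .tmp fun c => .push .inp c) <|
  .seq φ.prog <|
  .seq (.loop .inp fun _ => .skip) (.loop .len fun _ => .skip)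

open Classical in
/-- For every closed formula, it is decidable in polynomial time whether a string satisfies it. -/
theorem Fml.polyTime [DecidableEq ι] [Fintype ι] {α : Type} (enc : α → List Sym) (φ : Fml ι)
    (hφ : φ.WellScoped) :
    Nonempty (Turing.TM2ComputableInPolyTime enc Computability.encodeBool
      fun a => decide (φ.Holds (enc a) fun _ => 0)) := by
  refine polyTime_of_exec enc _ φ.check .inp .vals
    (.X * 3 + 1 + (.X * 2 + 1 + (φ.time + (.X * 2 + 1 + (.X * 2 + 1))))) fun a => ?_
  change Runs _ _ _ _
  generalize enc a = s
  have h₁ := runs_loop (k := Stk.inp (ι := ι)) (T := 2)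
    (f := fun c => .seq (.push .tmp c) (.push .len none))
    (fun j => Function.update (Function.update (Function.update (fun _ => []) .inp
      (s.drop (s.length - j))) .tmp (s.take (s.length - j)).reverse) .len (unary (s.length - j)))
    (by simp) s.length (fun j hj => by
      obtain ⟨c, hc, hc', hlt⟩ : ∃ c, s.length - (j + 1) = c ∧
        s.length - j = c + 1 ∧ c < s.length := ⟨_, rfl, by omega, by omega⟩
      simp only [hc, hc']
      refine ⟨s[c], s.drop (c + 1), ?_, ((runs_push _ _ _).seq (runs_push _ _ _)).congr rfl ?_⟩
      · simp only [ne_eq, reduceCtorEq, not_false_eq_true, Function.update_of_ne,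
          Function.update_self]
        exact List.drop_eq_getElem_cons hlt
      · funext x
        rcases x with _ | _ | _ | _ | _ | _ | _ | _ | i <;>
          simp [reverse_take_succ hlt, unary_succ])
  have h₂ := runs_pour (k := Stk.tmp (ι := ι)) (b := .inp) (by simp)
    (Function.update (Function.update (fun _ => []) .tmp s.reverse) .len (unary s.length))
  have h₃ := φ.runs_prog hφ s (fun _ => 0) (by simp) (by simp)
    (Function.update (Function.update (fun _ => []) .inp s) .len (unary s.length)) (by
      constructor <;> simp [unary])
  have h₄ := runs_clear .inp (Function.update (Function.update (Function.update (fun _ => [])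
    .inp s) .len (unary s.length)) (Stk.vals (ι := ι))
      [some (decide (φ.Holds s fun _ => 0))])
  have h₅ := runs_clear .len (Function.update (Function.update (fun _ => []) .len
    (unary s.length)) (Stk.vals (ι := ι)) [some (decide (φ.Holds s fun _ => 0))])
  refine (((h₁.congr ?_ ?_).seq (h₂.seq ((h₃.congr ?_ ?_).seq (h₄.seq
    (h₅.congr ?_ rfl))))).of_le ?_).congr rfl ?_
  · funext x
    rcases x with _ | _ | _ | _ | _ | _ | _ | _ | i <;> simp [unary]
  · funext x
    rcases x with _ | _ | _ | _ | _ | _ | _ | _ | i <;> simp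
  · funext x
    rcases x with _ | _ | _ | _ | _ | _ | _ | _ | i <;> simp
  · simp
  · funext x
    rcases x with _ | _ | _ | _ | _ | _ | _ | _ | i <;> simp
  · simp [unary]
  · funext x
    rcases x with _ | _ | _ | _ | _ | _ | _ | _ | i <;> simp

/-! ### Visibility in terms of coordinates -/

section Coordinates

variable {V R R' : Type*} [Add R] [LinearOrder R] [Add R'] [LinearOrder R']

/-- The right endpoint (for `b = true`) or left endpoint of the interval of length `d` at `x v`. -/
def endpoint (d : R) (x : V → R) (v : V) (b : Bool) : R := bif b then x v + d else x v

/-- The intervals of length `d` at the points `x v` and those of length `d'` at the points `x' v`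
have their endpoints in the same order. -/
def SameOrder (d : R) (x : V → R) (d' : R') (x' : V → R') : Prop :=
  ∀ u v b c, endpoint d x u b ≤ endpoint d x v c ↔ endpoint d' x' u b ≤ endpoint d' x' v c

theorem SameOrder.symm {d : R} {x : V → R} {d' : R'} {x' : V → R'} (h : SameOrder d x d' x') :
    SameOrder d' x' d x := fun u v b c => (h u v b c).symm

theorem SameOrder.trans {R'' : Type*} [Add R''] [LinearOrder R''] {d : R} {x : V → R} {d' : R'}
    {x' : V → R'} {d'' : R''} {x'' : V → R''} (h : SameOrder d x d' x')
    (h' : SameOrder d' x' d'' x'') : SameOrder d x d'' x'' :=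
  fun u v b c => (h u v b c).trans (h' u v b c)

/-- The square of side length `d` at `(x i, y i)` sees that at `(x j, y j)` from the left, along
a thin strip just above the height `τ`. -/
def LeftOf (d : R) (x y : V → R) (i j : V) : Prop :=
  x i + d < x j ∧ ∃ τ, y i ≤ τ ∧ τ < y i + d ∧ y j ≤ τ ∧ τ < y j + d ∧
    ∀ k, k ≠ i → k ≠ j → x i ≤ x k → x k ≤ x j → τ < y k ∨ y k + d ≤ τ

/-- The squares of side length `d` at the points `(x v, y v)` are pairwise disjoint, and `G` is
their visibility graph. -/
def IsLayout (d : R) (x y : V → R) (G : SimpleGraph V) : Prop :=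
  (∀ u v, u ≠ v → x u + d < x v ∨ x v + d < x u ∨ y u + d < y v ∨ y v + d < y u) ∧
    ∀ u v, G.Adj u v ↔ u ≠ v ∧
      ((LeftOf d x y u v ∨ LeftOf d x y v u) ∨ (LeftOf d y x u v ∨ LeftOf d y x v u))

/-- The height `τ` can be lowered to the next endpoint of an interval, which makes the condition
one on the order of the endpoints. -/
theorem LeftOf.of_sameOrder [Finite V] {d : R} {x y : V → R} {d' : R'} {x' y' : V → R'}
    (hx : SameOrder d x d' x') (hy : SameOrder d y d' y') {i j : V} (h : LeftOf d x y i j) :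
    LeftOf d' x' y' i j := by
  obtain ⟨hij, τ, h1, h2, h3, h4, h5⟩ := h
  obtain ⟨⟨z, δ⟩, hz, hmax⟩ := Set.exists_max_image
    {e : V × Bool | endpoint d y e.1 e.2 ≤ τ} (fun e => endpoint d y e.1 e.2) (Set.toFinite _)
    ⟨(i, false), h1⟩
  have key : ∀ v b, endpoint d y v b ≤ τ ↔ endpoint d' y' v b ≤ endpoint d' y' z δ := fun v b => by
    rw [← hy v z b δ]
    exact ⟨fun h => hmax (v, b) h, fun h => h.trans hz⟩
  have key' : ∀ v b, τ < endpoint d y v b ↔ endpoint d' y' z δ < endpoint d' y' v b :=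
    fun v b => by simpa using (key v b).not
  refine ⟨(lt_iff_lt_of_le_iff_le (hx j i false true)).1 hij, endpoint d' y' z δ,
    (key i false).1 h1, (key' i true).1 h2, (key j false).1 h3, (key' j true).1 h4,
    fun k hki hkj hik hkj' => ?_⟩
  exact (h5 k hki hkj ((hx i k false false).2 hik) ((hx k j false false).2 hkj')).imp
    (key' k false).1 (key k true).1

theorem leftOf_iff [Finite V] {d : R} {x y : V → R} {d' : R'} {x' y' : V → R'}
    (hx : SameOrder d x d' x') (hy : SameOrder d y d' y') (i j : V) :
    LeftOf d x y i j ↔ LeftOf d' x' y' i j :=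
  ⟨.of_sameOrder hx hy, .of_sameOrder hx.symm hy.symm⟩

theorem isLayout_iff [Finite V] {d : R} {x y : V → R} {d' : R'} {x' y' : V → R'}
    (hx : SameOrder d x d' x') (hy : SameOrder d y d' y') (G : SimpleGraph V) :
    IsLayout d x y G ↔ IsLayout d' x' y' G := by
  have hx' : ∀ u v, x u + d < x v ↔ x' u + d' < x' v := fun u v =>
    lt_iff_lt_of_le_iff_le (hx v u false true)
  have hy' : ∀ u v, y u + d < y v ↔ y' u + d' < y' v := fun u v =>
    lt_iff_lt_of_le_iff_le (hy v u false true)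
  simp only [IsLayout, leftOf_iff hx hy, leftOf_iff hy hx, hx', hy']

end Coordinates

theorem disjoint_unitSquare_iff (p q : ℝ × ℝ) : Disjoint (unitSquare p) (unitSquare q) ↔
    p.1 + 1 < q.1 ∨ q.1 + 1 < p.1 ∨ p.2 + 1 < q.2 ∨ q.2 + 1 < p.2 := by
  constructor
  · intro h
    by_contra! hc
    obtain ⟨h1, h2, h3, h4⟩ := hc
    refine absurd ?_ (Set.disjoint_left.1 h (?_ : (max p.1 q.1, max p.2 q.2) ∈ unitSquare p)) <;>
      refine ⟨⟨?_, ?_⟩, ?_, ?_⟩ <;> simp <;> linarith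
  · intro h
    rw [Set.disjoint_left]
    rintro ⟨a, b⟩ ⟨⟨h1, h2⟩, h3, h4⟩ ⟨⟨h5, h6⟩, h7, h8⟩
    dsimp only at *
    rcases h with h | h | h | h <;> linarith

/-- Only finitely many squares can block the view, so there is room just above `τ`. -/
theorem seesFromLeft_iff {V : Type*} [Finite V] (x y : V → ℝ) (i j : V)
    (hd : Disjoint (unitSquare (x i, y i)) (unitSquare (x j, y j))) :
    SeesFromLeft (fun v => unitSquare (x v, y v)) i j ↔ LeftOf 1 x y i j := by
  rw [disjoint_unitSquare_iff] at hd
  constructor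
  · rintro ⟨a, b, c, d, hab, hcd, hi, hj, hk⟩
    have hic : (a, c) ∈ unitSquare (x i, y i) := hi ⟨rfl, le_rfl, hcd.le⟩
    have hid : (a, d) ∈ unitSquare (x i, y i) := hi ⟨rfl, hcd.le, le_rfl⟩
    have hjc : (b, c) ∈ unitSquare (x j, y j) := hj ⟨rfl, le_rfl, hcd.le⟩
    have hjd : (b, d) ∈ unitSquare (x j, y j) := hj ⟨rfl, hcd.le, le_rfl⟩
    simp only [unitSquare, Set.mem_prod, Set.mem_Icc] at hic hid hjc hjd
    obtain ⟨⟨i1, i2⟩, i3, i4⟩ := hic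
    obtain ⟨⟨j1, j2⟩, j3, j4⟩ := hjc
    have i5 := hid.2.2
    have j5 := hjd.2.2
    have hij : x i + 1 < x j := by
      dsimp only at hd
      rcases hd with h | h | h | h <;> linarith
    refine ⟨hij, c, i3, by linarith, j3, by linarith, fun k hki hkj h1 h2 => ?_⟩
    by_contra! hc
    refine Set.eq_empty_iff_forall_notMem.1 (hk k hki hkj) (max a (x k), max c (y k))
      ⟨⟨⟨le_max_left _ _, max_le hab.le ?_⟩, le_max_left _ _, max_le hcd.le ?_⟩,
        ⟨le_max_right _ _, max_le ?_ ?_⟩, le_max_right _ _, max_le ?_ ?_⟩ <;>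
      linarith
  · rintro ⟨hij, τ, h1, h2, h3, h4, h5⟩
    have hev : ∀ᶠ t in nhdsWithin τ (Set.Ioi τ), τ < t ∧ t < y i + 1 ∧ t < y j + 1 ∧
        ∀ k, τ < y k → t < y k := by
      refine eventually_mem_nhdsWithin.and (.and ?_ (.and ?_ ?_))
      · exact (eventually_lt_nhds h2).filter_mono nhdsWithin_le_nhds
      · exact (eventually_lt_nhds h4).filter_mono nhdsWithin_le_nhds
      · refine Filter.eventually_all.2 fun k => ?_
        by_cases hk : τ < y k
        · filter_upwards [(eventually_lt_nhds hk).filter_mono nhdsWithin_le_nhds] with t ht _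
          exact ht
        · exact .of_forall fun t h => absurd h hk
    obtain ⟨t, ht, ht1, ht2, ht3⟩ := hev.exists
    refine ⟨x i + 1, x j, (τ + t) / 2, t, hij, by linarith, ?_, ?_, fun k hki hkj => ?_⟩
    · rintro ⟨a, b⟩ ⟨rfl, h6, h7⟩
      refine ⟨⟨?_, ?_⟩, ?_, ?_⟩ <;> dsimp only at * <;> linarith
    · rintro ⟨a, b⟩ ⟨rfl, h6, h7⟩
      refine ⟨⟨?_, ?_⟩, ?_, ?_⟩ <;> dsimp only at * <;> linarith
    · refine Set.eq_empty_iff_forall_notMem.2 ?_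
      rintro ⟨a, b⟩ ⟨⟨⟨h6, h7⟩, h8, h9⟩, ⟨h10, h11⟩, h12, h13⟩
      dsimp only at *
      rcases h5 k hki hkj (by linarith) (by linarith) with h | h
      · linarith [ht3 k h]
      · linarith

/-- Reflecting the plane in the diagonal exchanges the two kinds of visibility. -/
theorem seesFromAbove_iff {V : Type*} (x y : V → ℝ) (i j : V) :
    SeesFromAbove (fun v => unitSquare (x v, y v)) i j ↔
      SeesFromLeft (fun v => unitSquare (y v, x v)) j i := by
  have hpre : ∀ v, unitSquare (y v, x v) = Prod.swap ⁻¹' unitSquare (x v, y v) := fun v => by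
    rw [unitSquare, unitSquare, Set.preimage_swap_prod]
  have hsub : ∀ (A B : Set ℝ) v, A ×ˢ B ⊆ unitSquare (y v, x v) ↔
      B ×ˢ A ⊆ unitSquare (x v, y v) := fun A B v => by
    rw [hpre, ← Set.image_subset_iff, Set.image_swap_prod]
  have hint : ∀ (A B : Set ℝ) v, A ×ˢ B ∩ unitSquare (y v, x v) = ∅ ↔
      B ×ˢ A ∩ unitSquare (x v, y v) = ∅ := fun A B v => by
    rw [hpre, ← Set.preimage_swap_prod, ← Set.preimage_inter,
      Set.preimage_eq_empty_iff, Prod.swap_surjective.range_eq, Set.disjoint_univ]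
  simp only [SeesFromAbove, SeesFromLeft, hsub, hint]
  constructor
  · rintro ⟨a, b, c, d, hab, hcd, h1, h2, h3⟩
    exact ⟨c, d, a, b, hcd, hab, h2, h1, fun k hk hk' => h3 k hk' hk⟩
  · rintro ⟨c, d, a, b, hcd, hab, h2, h1, h3⟩
    exact ⟨a, b, c, d, hab, hcd, h1, h2, fun k hk hk' => h3 k hk' hk⟩

theorem represents_iff {V : Type*} [Finite V] (x y : V → ℝ) (G : SimpleGraph V) :
    Represents (fun v => (x v, y v)) G ↔ IsLayout 1 x y G := by
  unfold Represents IsLayout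
  have hdisj : (∀ u v, u ≠ v → Disjoint (unitSquare (x u, y u)) (unitSquare (x v, y v))) ↔ _ :=
    forall₂_congr fun u v => imp_congr_right fun _ =>
      disjoint_unitSquare_iff (x u, y u) (x v, y v)
  rw [← hdisj]
  refine and_congr_right fun hd => ?_
  have hd' : ∀ u v, u ≠ v → Disjoint (unitSquare (y u, x u)) (unitSquare (y v, x v)) :=
    fun u v huv => (disjoint_unitSquare_iff _ _).2 (by
      have := (disjoint_unitSquare_iff _ _).1 (hd u v huv)
      tauto)
  have hadj : ∀ u v, (visibilityGraph fun v => unitSquare (x v, y v)).Adj u v ↔ u ≠ v ∧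
      ((LeftOf 1 x y u v ∨ LeftOf 1 x y v u) ∨ (LeftOf 1 y x u v ∨ LeftOf 1 y x v u)) :=
    fun u v => and_congr_right fun huv => by
      rw [seesFromAbove_iff, seesFromAbove_iff, seesFromLeft_iff x y u v (hd u v huv),
        seesFromLeft_iff x y v u (hd v u huv.symm), seesFromLeft_iff y x u v (hd' u v huv),
        seesFromLeft_iff y x v u (hd' v u huv.symm), or_comm (a := LeftOf 1 y x v u)]
  constructor
  · rintro rfl
    exact hadj
  · intro h
    ext u v
    exact (hadj u v).trans (h u v).symm

/-! ### Layouts with small coordinates -/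

theorem sameOrder_shift {V : Type*} (x : V → ℝ) (c : ℝ) :
    SameOrder 1 x 1 fun v => x v + c := by
  intro u v b b'
  cases b <;> cases b' <;> simp [endpoint, add_right_comm _ c]

theorem sameOrder_div {V : Type*} (a : V → ℕ) (D : ℕ) (hD : 0 < D) :
    SameOrder D a (1 : ℝ) fun v => (a v : ℝ) / D := by
  have hD' : (0 : ℝ) < D := by exact_mod_cast hD
  intro u v b b'
  have h : ∀ (v : V) (b : Bool), endpoint (1 : ℝ) (fun v => (a v : ℝ) / D) v b =
      (endpoint D a v b : ℕ) / D := fun v b => by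
    cases b <;> simp [endpoint, add_div, hD'.ne']
  rw [h, h, div_le_div_iff_of_pos_right hD', Nat.cast_le]

/-- Keeping the integral parts and replacing each fractional part by its rank among all
fractional parts, real coordinates become multiples of `1 / n`. -/
theorem exists_sameOrder_nat {V : Type*} [Fintype V] (x : V → ℝ) :
    ∃ a : V → ℕ, SameOrder 1 x (Fintype.card V) a := by
  wlog hx : ∀ v, 0 ≤ x v generalizing x
  · obtain ⟨a, ha⟩ := this (fun v => x v + ∑ u, |x u|) fun v => by
      have := Finset.single_le_sum (f := fun u => |x u|) (fun u _ => abs_nonneg _)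
        (Finset.mem_univ v)
      have := neg_abs_le (x v)
      linarith
    exact ⟨a, (sameOrder_shift x _).trans ha⟩
  classical
  let r : V → ℝ := fun v => x v - ⌊x v⌋₊
  let k : V → ℕ := fun v => (Finset.univ.filter fun u => r u < r v).card
  have hr : ∀ v, 0 ≤ r v ∧ r v < 1 := fun v => by
    have h1 := Nat.floor_le (hx v)
    have h2 := Nat.lt_floor_add_one (x v)
    constructor <;> simp only [r] <;> linarith
  have hk : ∀ v, k v < Fintype.card V := fun v =>
    Finset.card_lt_univ_of_notMem (x := v) (by simp)
  have hrk : ∀ u v, r u ≤ r v ↔ k u ≤ k v := fun u v => by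
    constructor
    · intro h
      refine Finset.card_le_card fun w hw => ?_
      simp only [Finset.mem_filter, Finset.mem_univ, true_and] at hw ⊢
      exact hw.trans_le h
    · intro h
      by_contra! hlt
      refine h.not_gt (Finset.card_lt_card ?_)
      rw [Finset.ssubset_iff_of_subset fun w hw => ?_]
      · exact ⟨v, by simpa using hlt, by simp⟩
      · simp only [Finset.mem_filter, Finset.mem_univ, true_and] at hw ⊢
        exact hw.trans hlt
  -- Comparing `f + r u` means comparing `f` first, as the values of `r` are in `[0, 1)`, and the
  -- same holds for `f * n + k u`, as the ranks `k u` are less than `n`.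
  have key : ∀ (f f' : ℕ) (u v : V), (f : ℝ) + r u ≤ f' + r v ↔
      f * Fintype.card V + k u ≤ f' * Fintype.card V + k v := fun f f' u v => by
    rcases lt_trichotomy f f' with h | rfl | h
    · have h1 : (f : ℝ) + 1 ≤ f' := by exact_mod_cast h
      have h2 := Nat.mul_le_mul_right (Fintype.card V) (Nat.succ_le_of_lt h)
      rw [Nat.succ_mul] at h2
      have h3 := hk u
      have h4 := hr u
      have h5 := hr v
      exact iff_of_true (by linarith) (by omega)
    · simpa using hrk u v
    · have h1 : (f' : ℝ) + 1 ≤ f := by exact_mod_cast h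
      have h2 := Nat.mul_le_mul_right (Fintype.card V) (Nat.succ_le_of_lt h)
      rw [Nat.succ_mul] at h2
      have h3 := hk v
      have h4 := hr u
      have h5 := hr v
      exact iff_of_false (by linarith) (by omega)
  refine ⟨fun v => ⌊x v⌋₊ * Fintype.card V + k v, fun u v b c => ?_⟩
  have e : ∀ v b, endpoint 1 x v b = ((⌊x v⌋₊ + b.toNat : ℕ) : ℝ) + r v := fun v b => by
    cases b <;> simp [endpoint, r]
    ring
  have e' : ∀ v b, endpoint (Fintype.card V) (fun v => ⌊x v⌋₊ * Fintype.card V + k v) v b =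
      (⌊x v⌋₊ + b.toNat) * Fintype.card V + k v := fun v b => by
    cases b <;> simp [endpoint]
    ring
  rw [e, e, e', e', key]

/-- In an assignment of coordinates with minimal sum, all gaps between consecutive coordinates
are at most `D + 1`, because larger gaps could be shrunk. -/
theorem exists_sameOrder_small {V : Type*} [Fintype V] (a : V → ℕ) (D : ℕ) :
    ∃ b : V → ℕ, SameOrder D a D b ∧ ∀ v, b v ≤ (D + 1) * (Fintype.card V - 1) := by
  classical
  have hex : ∃ m, ∃ b : V → ℕ, SameOrder D a D b ∧ ∑ v, b v = m :=
    ⟨_, a, fun _ _ _ _ => Iff.rfl, rfl⟩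
  obtain ⟨b, hb, hsum⟩ := Nat.find_spec hex
  have hgap : ∀ v, 0 < b v → ∃ u, b u < b v ∧ b v ≤ b u + (D + 1) := by
    intro v hv
    by_contra! hno
    -- Otherwise, all coordinates from `b v` on can be decreased by one.
    refine Nat.find_min hex (m := ∑ u, if b u < b v then b u else b u - 1) ?_
      ⟨_, hb.trans fun u w β γ => ?_, rfl⟩
    · rw [← hsum]
      refine Finset.sum_lt_sum (fun u _ => ?_) ⟨v, Finset.mem_univ v, ?_⟩
      · split_ifs <;> omega
      · simp [hv]
    · have h1 := hno u
      have h2 := hno w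
      cases β <;> cases γ <;> simp only [endpoint, cond_true, cond_false] <;> split_ifs <;> omega
  -- By induction, `b v` is at most `D + 1` times the number of vertices with smaller coordinates.
  have hbound : ∀ m v, b v = m →
      b v ≤ (D + 1) * (Finset.univ.filter fun u => b u < b v).card := by
    intro m
    induction m using Nat.strong_induction_on with
    | _ m ih =>
      rintro v rfl
      rcases Nat.eq_zero_or_pos (b v) with h | h
      · omega
      · obtain ⟨u, hu, hu'⟩ := hgap v h
        have h1 := ih (b u) hu u rfl
        have h2 : (Finset.univ.filter fun w => b w < b u).card <
            (Finset.univ.filter fun w => b w < b v).card := by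
          refine Finset.card_lt_card ?_
          rw [Finset.ssubset_iff_of_subset fun w hw => ?_]
          · exact ⟨u, by simpa using hu, by simp⟩
          · simp only [Finset.mem_filter, Finset.mem_univ, true_and] at hw ⊢
            exact hw.trans hu
        have h3 := Nat.mul_le_mul_left (D + 1) (Nat.succ_le_of_lt h2)
        rw [Nat.mul_succ] at h3
        omega
  refine ⟨b, hb, fun v => (hbound _ v rfl).trans (Nat.mul_le_mul_left _ ?_)⟩
  exact Nat.le_sub_one_of_lt (Finset.card_lt_univ_of_notMem (x := v) (by simp))

/-- It suffices to replace the coordinates by natural numbers with the same order of endpoints. -/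
theorem exists_small_layout {V R : Type*} [Fintype V] [Add R] [LinearOrder R] {d : R}
    {x y : V → R} {G : SimpleGraph V} (D : ℕ) {a b : V → ℕ} (ha : SameOrder d x D a)
    (hb : SameOrder d y D b) (h : IsLayout d x y G) :
    ∃ a b : V → ℕ, (∀ v, a v ≤ (D + 1) * (Fintype.card V - 1) ∧
      b v ≤ (D + 1) * (Fintype.card V - 1)) ∧ IsLayout D a b G := by
  obtain ⟨a', ha', hba⟩ := exists_sameOrder_small a D
  obtain ⟨b', hb', hbb⟩ := exists_sameOrder_small b D
  exact ⟨a', b', fun v => ⟨hba v, hbb v⟩,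
    (isLayout_iff (ha.trans ha') (hb.trans hb') G).1 h⟩

/-- Layouts with integral coordinates for squares of side length `D` are layouts of unit squares
with coordinates in `{k / D : k ∈ ℕ}`. -/
theorem isLayout_nat_iff {V : Type*} [Finite V] (D : ℕ) (hD : 0 < D) (a b : V → ℕ)
    (G : SimpleGraph V) :
    IsLayout D a b G ↔ Represents (fun v => ((a v : ℝ) / D, (b v : ℝ) / D)) G := by
  rw [represents_iff (fun v => (a v : ℝ) / D) (fun v => (b v : ℝ) / D)]
  exact isLayout_iff (sameOrder_div a D hD) (sameOrder_div b D hD) G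

theorem isLayout_one_iff {V : Type*} [Finite V] (q : V → ℕ × ℕ) (G : SimpleGraph V) :
    IsLayout 1 (fun v => (q v).1) (fun v => (q v).2) G ↔
      Represents (fun v => gridPosition (q v)) G := by
  simpa [gridPosition] using isLayout_nat_iff 1 one_pos (fun v => (q v).1) (fun v => (q v).2) G

theorem IsUSV.exists_layout {V : Type*} [Fintype V] {G : SimpleGraph V} (h : IsUSV G) :
    ∃ a b : V → ℕ, (∀ v, a v ≤ Fintype.card V ^ 2 ∧ b v ≤ Fintype.card V ^ 2) ∧
      IsLayout (Fintype.card V) a b G := by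
  obtain ⟨p, hp⟩ := h
  obtain ⟨a, ha⟩ := exists_sameOrder_nat fun v => (p v).1
  obtain ⟨b, hb⟩ := exists_sameOrder_nat fun v => (p v).2
  obtain ⟨a', b', hab, hl⟩ := exists_small_layout _ ha hb ((represents_iff _ _ G).1 hp)
  have hle : (Fintype.card V + 1) * (Fintype.card V - 1) ≤ Fintype.card V ^ 2 := by
    rcases Fintype.card V with _ | n
    · simp
    · simp only [Nat.add_sub_cancel]
      nlinarith
  exact ⟨a', b', fun v => ⟨(hab v).1.trans hle, (hab v).2.trans hle⟩, hl⟩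

theorem IsUSGV.exists_layout {V : Type*} [Fintype V] {G : SimpleGraph V} (h : IsUSGV G) :
    ∃ a b : V → ℕ, (∀ v, a v ≤ 2 * (Fintype.card V - 1) ∧ b v ≤ 2 * (Fintype.card V - 1)) ∧
      IsLayout 1 a b G := by
  obtain ⟨q, hq⟩ := h
  exact exists_small_layout 1 (fun _ _ _ _ => Iff.rfl) (fun _ _ _ _ => Iff.rfl)
    ((isLayout_one_iff q G).2 hq)

/-! ### The formula verifying a layout -/

namespace Fml

variable {ι : Type}

/-- Disjunction. -/
def or (φ ψ : Fml ι) : Fml ι := not (and (not φ) (not ψ))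

/-- Implication. -/
def imp (φ ψ : Fml ι) : Fml ι := not (and φ (not ψ))

/-- Equivalence. -/
def iff (φ ψ : Fml ι) : Fml ι := and (imp φ ψ) (imp ψ φ)

/-- Universal quantification. -/
def all (i : ι) (φ : Fml ι) : Fml ι := not (ex i (not φ))

/-- Strict inequality. -/
def lt (t u : Term ι) : Fml ι := le (.add t .one) u

/-- Equality. -/
def eq (t u : Term ι) : Fml ι := and (le t u) (le u t)

variable [DecidableEq ι] {s : List Sym} {e : ι → ℕ} {φ ψ : Fml ι} {t u : Term ι} {i : ι} {a : Sym}

theorem holds_letter : (letter a t).Holds s e ↔ s[t.val e]? = some a := Iff.rfl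

theorem holds_le : (le t u).Holds s e ↔ t.val e ≤ u.val e := Iff.rfl

theorem holds_not : (not φ).Holds s e ↔ ¬ φ.Holds s e := Iff.rfl

theorem holds_and : (and φ ψ).Holds s e ↔ φ.Holds s e ∧ ψ.Holds s e := Iff.rfl

theorem holds_ex : (ex i φ).Holds s e ↔ ∃ n < s.length, φ.Holds s (Function.update e i n) :=
  Iff.rfl

theorem holds_or : (or φ ψ).Holds s e ↔ φ.Holds s e ∨ ψ.Holds s e := by
  simp only [or, holds_not, holds_and]
  tauto

theorem holds_imp : (imp φ ψ).Holds s e ↔ (φ.Holds s e → ψ.Holds s e) := by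
  simp only [imp, holds_not, holds_and]
  tauto

theorem holds_iff : (iff φ ψ).Holds s e ↔ (φ.Holds s e ↔ ψ.Holds s e) := by
  simp only [iff, holds_imp, holds_and]
  tauto

theorem holds_all : (all i φ).Holds s e ↔ ∀ n < s.length, φ.Holds s (Function.update e i n) := by
  simp only [all, holds_not, holds_ex]
  push Not
  rfl

theorem holds_lt : (lt t u).Holds s e ↔ t.val e < u.val e := Iff.rfl

theorem holds_eq : (eq t u).Holds s e ↔ t.val e = u.val e :=
  le_antisymm_iff.symm

end Fml

/-- The side length of the squares, with integral coordinates, in layouts with `n` squares. -/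
def sideLength (grid : Bool) (n : ℕ) : ℕ := bif grid then 1 else n

section Semantics

variable (s : List Sym) (n C : ℕ)

/-- The `k`-th first (for `y = false`) or second (for `y = true`) coordinate given by the
certificate contained in the string `s` is `t`. The certificate follows the instance of length
`n + n * n + 1` and the separator, and consists of a row of `C` bits for each coordinate. -/
def Table (y : Bool) (k t : ℕ) : Prop :=
  t < C ∧ s[n + n * n + 1 + 1 + (bif y then n * C else 0) + k * C + t]? = some (some true)

/-- The certificate assigns coordinates to all vertices. -/
def IsTable (y : Bool) : Prop :=
  ∀ u < s.length, u < n → (∃ t < s.length, Table s n C y u t) ∧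
    ∀ t < s.length, ∀ t' < s.length, Table s n C y u t → Table s n C y u t' → t = t'

/-- `LeftOf` for the coordinates given by the certificate, those of the squares `u` and `v` being
`(pu, qu)` and `(pv, qv)`. -/
def TableLeftOf (D : ℕ) (y : Bool) (u v pu qu pv qv : ℕ) : Prop :=
  pu + D < pv ∧ ∃ τ < s.length, qu ≤ τ ∧ τ < qu + D ∧ qv ≤ τ ∧ τ < qv + D ∧
    ∀ k < s.length, ∀ pk < s.length, ∀ qk < s.length, k < n → k ≠ u → k ≠ v →
      Table s n C y k pk → Table s n C (!y) k qk → pu ≤ pk → pk ≤ pv → τ < qk ∨ qk + D ≤ τ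

/-- The layout given by the certificate represents the graph given by the instance. -/
def TableLayout (D : ℕ) : Prop :=
  ∀ u < s.length, ∀ v < s.length, ∀ au < s.length, ∀ bu < s.length, ∀ av < s.length,
    ∀ bv < s.length, u < n → v < n → Table s n C false u au → Table s n C true u bu →
    Table s n C false v av → Table s n C true v bv →
    (u ≠ v → au + D < av ∨ av + D < au ∨ bu + D < bv ∨ bv + D < bu) ∧
    (s[n + 1 + u * n + v]? = some (some true) ↔ u ≠ v ∧
      ((TableLeftOf s n C D false u v au bu av bv ∨ TableLeftOf s n C D false v u av bv au bu) ∨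
        (TableLeftOf s n C D true u v bu au bv av ∨ TableLeftOf s n C D true v u bv av bu au)))

/-- The string consists of the encoding of a graph and a certificate describing a layout. -/
def Accepts (grid : Bool) : Prop :=
  ∃ n < s.length, ∃ C < s.length, C = n * n + 1 ∧
    (∀ p < s.length, p < n → s[p]? = some (some true)) ∧ s[n]? = some (some false) ∧
    s[n + n * n + 1]? = some none ∧ IsTable s n C false ∧ IsTable s n C true ∧
    TableLayout s n C (sideLength grid n)

end Semantics

namespace Verifier

open Term Fml

/-- The variables of the formula expressing `Accepts`: variable `0` is the number of vertices,
`1` the length of the rows of the table, `2` to `7` are two vertices and their coordinates, `8` is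
the height of a strip, and `9` to `11` are a vertex and its coordinates. -/
abbrev Var := Fin 12

/-- The formula expressing `Table`. -/
def table (y : Bool) (k t : Var) : Fml Var :=
  and (lt (var t) (var 1)) <| letter (some true) <|
    add (add (bif y then
      add (add (add (add (var 0) (mul 0 0)) one) one) (mul 0 1)
      else add (add (add (var 0) (mul 0 0)) one) one) (mul k 1)) (var t)

/-- The term denoting `sideLength`. -/
def side (grid : Bool) : Term Var := bif grid then one else var 0

/-- The formula expressing `IsTable`. -/
def isTable (y : Bool) : Fml Var :=
  all 2 <| imp (lt (var 2) (var 0)) <|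
    and (ex 3 (table y 2 3)) <|
      all 3 <| all 4 <| imp (table y 2 3) <| imp (table y 2 4) <| eq (var 3) (var 4)

/-- The formula expressing `TableLeftOf`. -/
def leftOf (grid y : Bool) (u v pu qu pv qv : Var) : Fml Var :=
  and (lt (add (var pu) (side grid)) (var pv)) <| ex 8 <|
    and (le (var qu) (var 8)) <| and (lt (var 8) (add (var qu) (side grid))) <|
    and (le (var qv) (var 8)) <| and (lt (var 8) (add (var qv) (side grid))) <|
    all 9 <| all 10 <| all 11 <|
      imp (lt (var 9) (var 0)) <| imp (not (eq (var 9) (var u))) <|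
      imp (not (eq (var 9) (var v))) <| imp (table y 9 10) <| imp (table (!y) 9 11) <|
      imp (le (var pu) (var 10)) <| imp (le (var 10) (var pv)) <|
        or (lt (var 8) (var 11)) (le (add (var 11) (side grid)) (var 8))

/-- The formula expressing `TableLayout`. -/
def layout (grid : Bool) : Fml Var :=
  all 2 <| all 3 <| all 4 <| all 5 <| all 6 <| all 7 <|
    imp (lt (var 2) (var 0)) <| imp (lt (var 3) (var 0)) <|
    imp (table false 2 4) <| imp (table true 2 5) <|
    imp (table false 3 6) <| imp (table true 3 7) <|
    and (imp (not (eq (var 2) (var 3))) <|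
      or (lt (add (var 4) (side grid)) (var 6)) <| or (lt (add (var 6) (side grid)) (var 4)) <|
      or (lt (add (var 5) (side grid)) (var 7)) (lt (add (var 7) (side grid)) (var 5))) <|
    iff (letter (some true) (add (add (add (var 0) one) (mul 2 0)) (var 3))) <|
      and (not (eq (var 2) (var 3))) <|
        or (or (leftOf grid false 2 3 4 5 6 7) (leftOf grid false 3 2 6 7 4 5))
          (or (leftOf grid true 2 3 5 4 7 6) (leftOf grid true 3 2 7 6 5 4))

/-- The formula expressing `Accepts`. -/
def accepts (grid : Bool) : Fml Var :=
  ex 0 <| ex 1 <| and (eq (var 1) (add (mul 0 0) one)) <|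
    and (all 2 <| imp (lt (var 2) (var 0)) (letter (some true) (var 2))) <|
    and (letter (some false) (var 0)) <|
    and (letter none (add (add (var 0) (mul 0 0)) one)) <|
    and (isTable false) <| and (isTable true) (layout grid)

theorem wellScoped_accepts (grid : Bool) : (accepts grid).WellScoped := by
  cases grid <;> simp [accepts, isTable, layout, leftOf, table, all, imp, Fml.or, iff, eq, lt,
    WellScoped, Binds]

variable {s : List Sym} {e : Var → ℕ}

theorem holds_table (y : Bool) (k t : Var) :
    (table y k t).Holds s e ↔ Table s (e 0) (e 1) y (e k) (e t) := by
  cases y <;> exact Iff.rfl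

theorem val_side (grid : Bool) : (side grid).val e = sideLength grid (e 0) := by
  cases grid <;> rfl

theorem holds_isTable (y : Bool) : (isTable y).Holds s e ↔ IsTable s (e 0) (e 1) y := by
  simp [isTable, IsTable, holds_and, holds_all, holds_imp, holds_lt, holds_ex, holds_table,
    holds_eq, val]

theorem holds_leftOf (grid y : Bool) (u v pu qu pv qv : Var)
    (h : ∀ i ∈ [u, v, pu, qu, pv, qv], i < 8) :
    (leftOf grid y u v pu qu pv qv).Holds s e ↔
      TableLeftOf s (e 0) (e 1) (sideLength grid (e 0)) y (e u) (e v) (e pu) (e qu) (e pv)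
        (e qv) := by
  have h' : ∀ i ∈ [u, v, pu, qu, pv, qv], i ≠ 8 ∧ i ≠ 9 ∧ i ≠ 10 ∧ i ≠ 11 := fun i hi => by
    have := h i hi
    refine ⟨?_, ?_, ?_, ?_⟩ <;> rintro rfl <;> revert this <;> decide
  simp only [List.mem_cons, List.not_mem_nil, or_false, forall_eq_or_imp, forall_eq] at h'
  obtain ⟨h1, h2, h3, h4, h5, h6⟩ := h'
  simp [leftOf, TableLeftOf, holds_and, holds_all, holds_imp, holds_lt, holds_le, holds_ex,
    holds_table, holds_eq, holds_not, holds_or, val, val_side, h1, h2, h3, h4, h5, h6]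

theorem holds_layout (grid : Bool) :
    (layout grid).Holds s e ↔ TableLayout s (e 0) (e 1) (sideLength grid (e 0)) := by
  simp [layout, TableLayout, holds_and, holds_all, holds_imp, holds_lt, holds_table, holds_eq,
    holds_not, holds_or, holds_iff, holds_letter, holds_leftOf, val, val_side]

theorem holds_accepts (grid : Bool) : (accepts grid).Holds s e ↔ Accepts s grid := by
  simp [accepts, Accepts, holds_and, holds_all, holds_imp, holds_lt, holds_ex,
    holds_eq, holds_letter, holds_isTable, holds_layout, val]

end Verifier

/-! ### Correctness of the verification -/

section Strings

variable {α : Type} {m k : ℕ}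

theorem length_flatten_ofFn (f : Fin m → Fin k → α) :
    (List.ofFn fun i => List.ofFn fun j => f i j).flatten.length = m * k := by
  simp [List.length_flatten, List.map_ofFn, Function.comp_def]

theorem getElem?_flatten_ofFn (f : Fin m → Fin k → α) (i : Fin m) (j : Fin k) :
    (List.ofFn fun i => List.ofFn fun j => f i j).flatten[(i : ℕ) * k + j]? = some (f i j) := by
  have h := List.ofFn_mul fun p : Fin (m * k) => f p.divNat p.modNat
  have e : ∀ (i : Fin m) (j : Fin k) h, (⟨i * k + j, h⟩ : Fin (m * k)).divNat = i ∧
      (⟨i * k + j, h⟩ : Fin (m * k)).modNat = j := fun i j h => by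
    have hk : 0 < k := j.pos
    constructor <;> ext
    · simp [Fin.divNat, Nat.add_div_of_dvd_right (Dvd.intro_left _ rfl), hk, Nat.div_eq_of_lt j.2]
    · simp [Fin.modNat, Nat.mod_eq_of_lt j.2]
  simp only [e] at h
  have hlt : (i : ℕ) * k + j < m * k := calc
    (i : ℕ) * k + j < (i + 1) * k := by rw [Nat.succ_mul]; exact Nat.add_lt_add_left j.2 _
    _ ≤ m * k := Nat.mul_le_mul_right _ i.2
  rw [← h, List.getElem?_ofFn, dif_pos hlt, (e i j hlt).1, (e i j hlt).2]

variable {n : ℕ} (G : SimpleGraph (Fin n))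

theorem length_encodeGraph : (encodeGraph G).length = n + n * n + 1 := by
  have h := length_flatten_ofFn fun i j : Fin n => @decide (G.Adj i j) (Classical.propDecidable _)
  simp only [encodeGraph, List.length_append, List.length_replicate, List.length_cons, h]
  ring

theorem getElem?_encodeGraph_of_lt {p : ℕ} (hp : p < n) : (encodeGraph G)[p]? = some true := by
  rw [encodeGraph, List.getElem?_append_left (by simpa using hp)]
  simp [hp]

theorem getElem?_encodeGraph_self : (encodeGraph G)[n]? = some false := by
  rw [encodeGraph, List.getElem?_append_right (by simp)]
  simp

theorem getElem?_encodeGraph_adj (u v : Fin n) [Decidable (G.Adj u v)] :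
    (encodeGraph G)[n + 1 + u * n + v]? = some (decide (G.Adj u v)) := by
  rw [encodeGraph, List.getElem?_append_right (by simp; omega)]
  have e : n + 1 + (u : ℕ) * n + v - (List.replicate n true).length = u * n + v + 1 := by
    simp; omega
  rw [e, List.getElem?_cons_succ, getElem?_flatten_ofFn]
  congr

theorem getElem?_encodePair_left (x w : List Bool) {p : ℕ} (hp : p < x.length) :
    (encodePair (x, w))[p]? = x[p]?.map some := by
  rw [encodePair, List.getElem?_append_left (by simpa using hp), List.getElem?_map]

theorem getElem?_encodePair_eq_none (x w : List Bool) (p : ℕ) :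
    (encodePair (x, w))[p]? = some none ↔ p = x.length := by
  rw [encodePair]
  rcases lt_trichotomy p x.length with h | rfl | h
  · rw [List.getElem?_append_left (by simpa using h)]
    simp [h, h.ne]
  · rw [List.getElem?_append_right (by simp)]
    simp
  · obtain ⟨q, rfl⟩ := Nat.exists_eq_add_of_lt h
    rw [List.getElem?_append_right (by simp; omega)]
    simp [Nat.add_assoc]

theorem getElem?_encodePair_right (x w : List Bool) (p : ℕ) :
    (encodePair (x, w))[x.length + 1 + p]? = w[p]?.map some := by
  rw [encodePair, List.getElem?_append_right (by simp; omega)]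
  simp [Nat.add_assoc, Nat.add_comm 1]

theorem length_encodePair (x w : List Bool) :
    (encodePair (x, w)).length = x.length + 1 + w.length := by
  simp [encodePair]
  omega

end Strings

section Layout

variable {s : List Sym} {n C D : ℕ}

/-- The bounds on the coordinates ensure that the height of the strip is a position in the
string. -/
theorem tableLeftOf_iff {y : Bool} {p q : Fin n → ℕ} (hn : n < s.length)
    (hp : ∀ (k : Fin n) t, Table s n C y k t ↔ t = p k) (hq : ∀ (k : Fin n) t, Table s n C (!y) k t ↔ t = q k)
    (hp' : ∀ k, p k < s.length) (hq' : ∀ k, q k + D ≤ s.length) (hD : n ≠ 0 → 0 < D)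
    (u v : Fin n) :
    TableLeftOf s n C D y u v (p u) (q u) (p v) (q v) ↔ LeftOf D p q u v := by
  have hD' : 0 < D := hD (by have := u.pos; omega)
  refine and_congr_right fun _ => ⟨?_, ?_⟩
  · rintro ⟨τ, -, h1, h2, h3, h4, h5⟩
    refine ⟨τ, h1, h2, h3, h4, fun k hku hkv => ?_⟩
    exact h5 k (k.2.trans hn) (p k) (hp' k) (q k) (by have := hq' k; omega) k.2
      (fun h => hku (Fin.ext h)) (fun h => hkv (Fin.ext h)) ((hp k _).2 rfl) ((hq k _).2 rfl)
  · rintro ⟨τ, h1, h2, h3, h4, h5⟩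
    refine ⟨τ, h2.trans_le (hq' u), h1, h2, h3, h4,
      fun k _ pk _ qk _ hk hku hkv hpk hqk => ?_⟩
    obtain rfl := (hp ⟨k, hk⟩ pk).1 hpk
    obtain rfl := (hq ⟨k, hk⟩ qk).1 hqk
    exact h5 ⟨k, hk⟩ (fun h => hku (congrArg Fin.val h)) (fun h => hkv (congrArg Fin.val h))

/-- If the certificate gives the coordinates `a` and `b`, then `TableLayout` says that they are a
layout representing the graph given by the instance. -/
theorem tableLayout_iff {a b : Fin n → ℕ} (hn : n < s.length)
    (ha : ∀ (k : Fin n) t, Table s n C false k t ↔ t = a k)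
    (hb : ∀ (k : Fin n) t, Table s n C true k t ↔ t = b k)
    (ha' : ∀ k, a k + D ≤ s.length) (hb' : ∀ k, b k + D ≤ s.length) (hD : n ≠ 0 → 0 < D) :
    TableLayout s n C D ↔
      (∀ u v, u ≠ v → a u + D < a v ∨ a v + D < a u ∨ b u + D < b v ∨ b v + D < b u) ∧
      ∀ u v : Fin n, s[n + 1 + u * n + v]? = some (some true) ↔ u ≠ v ∧
        ((LeftOf D a b u v ∨ LeftOf D a b v u) ∨ (LeftOf D b a u v ∨ LeftOf D b a v u)) := by
  have hlt : ∀ k, a k < s.length ∧ b k < s.length := fun k => by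
    have := hD (by have := k.pos; omega)
    have := ha' k
    have := hb' k
    omega
  have h₁ := tableLeftOf_iff hn ha hb (fun k => (hlt k).1) hb' hD
  have h₂ := tableLeftOf_iff hn hb ha (fun k => (hlt k).2) ha' hD
  constructor
  · intro h
    have h' := fun u v : Fin n => h u (u.2.trans hn) v (v.2.trans hn) _ (hlt u).1 _ (hlt u).2
      _ (hlt v).1 _ (hlt v).2 u.2 v.2 ((ha u _).2 rfl) ((hb u _).2 rfl) ((ha v _).2 rfl)
      ((hb v _).2 rfl)
    refine ⟨fun u v huv => (h' u v).1 fun e => huv (Fin.ext e), fun u v => ?_⟩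
    rw [(h' u v).2, h₁, h₁, h₂, h₂, Ne, Ne, Fin.val_inj]
  · rintro ⟨hdisj, hadj⟩ u - v - au - bu - av - bv - hu hv hau hbu hav hbv
    obtain ⟨u, rfl⟩ : ∃ u' : Fin n, (u' : ℕ) = u := ⟨⟨u, hu⟩, rfl⟩
    obtain ⟨v, rfl⟩ : ∃ v' : Fin n, (v' : ℕ) = v := ⟨⟨v, hv⟩, rfl⟩
    obtain rfl := (ha u au).1 hau
    obtain rfl := (hb u bu).1 hbu
    obtain rfl := (ha v av).1 hav
    obtain rfl := (hb v bv).1 hbv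
    refine ⟨fun e => hdisj u v fun e' => e (congrArg Fin.val e'), ?_⟩
    rw [hadj, h₁, h₁, h₂, h₂, Ne, Ne, Fin.val_inj]

end Layout

theorem sideLength_pos (grid : Bool) {n : ℕ} (hn : n ≠ 0) : 0 < sideLength grid n := by
  cases grid <;> simp [sideLength]
  omega

theorem sideLength_le (grid : Bool) {n : ℕ} (hn : n ≠ 0) : sideLength grid n ≤ n := by
  cases grid <;> simp [sideLength]
  omega

/-- Coordinates in an accepted certificate are those of a layout. -/
theorem exists_layout_of_accepts {grid : Bool} {x w : List Bool}
    (h : Accepts (encodePair (x, w)) grid) :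
    ∃ (n : ℕ) (G : SimpleGraph (Fin n)) (a b : Fin n → ℕ),
      IsLayout (sideLength grid n) a b G ∧ x = encodeGraph G := by
  obtain ⟨n, hn, C, hC, rfl, htrue, hfalse, hsep, hA, hB, hL⟩ := h
  set s := encodePair (x, w) with hs
  have hx : n + n * n + 1 = x.length := (getElem?_encodePair_eq_none x w _).1 hsep
  have hN : x.length < s.length := by rw [hs, length_encodePair]; omega
  have htab : ∀ y, IsTable s n (n * n + 1) y → ∃ a : Fin n → ℕ, (∀ k, a k < n * n + 1) ∧
      ∀ (k : Fin n) t, Table s n (n * n + 1) y k t ↔ t = a k := fun y hy => by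
    choose a ha ha' using fun k : Fin n => (hy k (k.2.trans hn) k.2).1
    refine ⟨a, fun k => (ha' k).1, fun k t => ⟨fun ht => ?_, fun ht => ht ▸ ha' k⟩⟩
    exact (hy k (k.2.trans hn) k.2).2 t (ht.1.trans hC) (a k) (ha k) ht (ha' k)
  obtain ⟨a, ha, ha'⟩ := htab _ hA
  obtain ⟨b, hb, hb'⟩ := htab _ hB
  -- The instance alone has length `n + n * n + 1`, which leaves room for the heights of strips.
  have hD : ∀ k : Fin n, n * n + 1 + sideLength grid n ≤ s.length := fun k => by
    have := sideLength_le grid (n := n) (by have := k.pos; omega)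
    omega
  let A : Fin n → Fin n → Prop := fun u v =>
    (LeftOf (sideLength grid n) a b u v ∨ LeftOf (sideLength grid n) a b v u) ∨
      (LeftOf (sideLength grid n) b a u v ∨ LeftOf (sideLength grid n) b a v u)
  let G : SimpleGraph (Fin n) :=
    { Adj := fun u v => u ≠ v ∧ A u v
      symm := ⟨fun _ _ h => ⟨h.1.symm, h.2.imp Or.symm Or.symm⟩⟩
      loopless := ⟨fun _ h => h.1 rfl⟩ }
  obtain ⟨hdisj, hadj⟩ := (tableLayout_iff hn ha' hb'
    (fun k => by have := ha k; have := hD k; omega)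
    (fun k => by have := hb k; have := hD k; omega) (sideLength_pos grid)).1 hL
  have hl : IsLayout (sideLength grid n) a b G := ⟨hdisj, fun u v => Iff.rfl⟩
  refine ⟨n, G, a, b, hl, List.ext_getElem (by rw [length_encodeGraph, hx]) fun p hp hp' => ?_⟩
  have e₁ : s[p]? = some (some x[p]) := by
    rw [hs, getElem?_encodePair_left x w hp]
    simp [hp]
  rw [← Option.some_inj, ← List.getElem?_eq_getElem hp']
  rcases lt_trichotomy p n with h | rfl | h
  · rw [getElem?_encodeGraph_of_lt G h]
    simpa [e₁] using htrue p (h.trans hn) h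
  · rw [getElem?_encodeGraph_self G]
    simpa [e₁] using hfalse
  · obtain ⟨q, rfl⟩ := Nat.exists_eq_add_of_lt h
    have hq : q < n * n := by omega
    have hn0 : 0 < n := Nat.pos_of_ne_zero (by rintro rfl; simp at hq)
    -- The position belongs to row `q / n` and column `q % n` of the adjacency matrix.
    have hqu : q / n < n := Nat.div_lt_of_lt_mul hq
    have hqv : q % n < n := Nat.mod_lt _ hn0
    have e₂ : n + 1 + q / n * n + q % n = n + q + 1 := by
      have := Nat.div_add_mod' q n
      omega
    classical
    have e₃ := getElem?_encodeGraph_adj G ⟨q / n, hqu⟩ ⟨q % n, hqv⟩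
    have e₄ : _ ↔ G.Adj ⟨q / n, hqu⟩ ⟨q % n, hqv⟩ := hadj ⟨q / n, hqu⟩ ⟨q % n, hqv⟩
    rw [e₂] at e₃ e₄
    rw [e₃, Option.some_inj, Bool.eq_iff_iff, decide_eq_true_iff, ← e₄, e₁]
    simp

/-- The bits of the certificate for the coordinates `a` and `b`. -/
def certificate {n : ℕ} (a b : Fin n → ℕ) : List Bool :=
  (List.ofFn fun u : Fin n => List.ofFn fun t : Fin (n * n + 1) => decide (a u = t)).flatten ++
    (List.ofFn fun u : Fin n => List.ofFn fun t : Fin (n * n + 1) => decide (b u = t)).flatten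

theorem length_certificate {n : ℕ} (a b : Fin n → ℕ) :
    (certificate a b).length = 2 * (n * (n * n + 1)) := by
  rw [certificate, List.length_append, length_flatten_ofFn, length_flatten_ofFn, two_mul]

/-- Layouts with small coordinates have accepted certificates. -/
theorem accepts_certificate {grid : Bool} {n : ℕ} {a b : Fin n → ℕ} {G : SimpleGraph (Fin n)}
    (ha : ∀ k, a k ≤ n * n) (hb : ∀ k, b k ≤ n * n) (h : IsLayout (sideLength grid n) a b G) :
    Accepts (encodePair (encodeGraph G, certificate a b)) grid := by
  set s := encodePair (encodeGraph G, certificate a b) with hs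
  have hx := length_encodeGraph G
  have hN : n + n * n + 1 < s.length := by rw [hs, length_encodePair]; omega
  have hleft : ∀ p < n + n * n + 1, s[p]? = (encodeGraph G)[p]?.map some := fun p hp =>
    getElem?_encodePair_left _ _ (by rwa [hx])
  have hright : ∀ p, s[n + n * n + 1 + 1 + p]? = (certificate a b)[p]?.map some := fun p => by
    rw [hs, ← hx, getElem?_encodePair_right]
  -- The first half of the certificate is the table of `a`, the second half that of `b`.
  have hA : ∀ (k : Fin n) t, Table s n (n * n + 1) false k t ↔ t = a k := fun k t => by
    have h1 : ∀ ht : t < n * n + 1, (certificate a b)[(k : ℕ) * (n * n + 1) + t]? =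
        some (decide (a k = t)) := fun ht => by
      have h2 := getElem?_flatten_ofFn (fun (u : Fin n) (t : Fin (n * n + 1)) =>
        decide (a u = t)) k ⟨t, ht⟩
      rw [certificate, List.getElem?_append_left (List.getElem?_eq_some_iff.1 h2).1, h2]
    rw [Table, cond_false, Nat.add_zero, Nat.add_assoc _ ((k : ℕ) * _), hright]
    constructor
    · rintro ⟨ht, h2⟩
      simpa [h1 ht, eq_comm] using h2
    · rintro rfl
      have := ha k
      exact ⟨by omega, by simp [h1 (by omega)]⟩
  have hB : ∀ (k : Fin n) t, Table s n (n * n + 1) true k t ↔ t = b k := fun k t => by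
    have h1 : ∀ ht : t < n * n + 1,
        (certificate a b)[n * (n * n + 1) + ((k : ℕ) * (n * n + 1) + t)]? =
        some (decide (b k = t)) := fun ht => by
      have h2 := getElem?_flatten_ofFn (fun (u : Fin n) (t : Fin (n * n + 1)) =>
        decide (b u = t)) k ⟨t, ht⟩
      rw [certificate, List.getElem?_append_right (by rw [length_flatten_ofFn]; omega),
        length_flatten_ofFn, Nat.add_sub_cancel_left, h2]
    rw [Table, cond_true, Nat.add_assoc _ ((k : ℕ) * _), Nat.add_assoc _ (n * _), hright]
    constructor
    · rintro ⟨ht, h2⟩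
      simpa [h1 ht, eq_comm] using h2
    · rintro rfl
      have := hb k
      exact ⟨by omega, by simp [h1 (by omega)]⟩
  have htab : ∀ y (c : Fin n → ℕ), (∀ k, c k ≤ n * n) →
      (∀ (k : Fin n) t, Table s n (n * n + 1) y k t ↔ t = c k) → IsTable s n (n * n + 1) y :=
    fun y c hc hy u _ hu =>
      ⟨⟨c ⟨u, hu⟩, by have := hc ⟨u, hu⟩; omega, (hy ⟨u, hu⟩ _).2 rfl⟩,
        fun t _ t' _ ht ht' => ((hy ⟨u, hu⟩ t).1 ht).trans ((hy ⟨u, hu⟩ t').1 ht').symm⟩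
  have hD : ∀ k : Fin n, n * n + sideLength grid n ≤ s.length := fun k => by
    have := sideLength_le grid (n := n) (by have := k.pos; omega)
    omega
  refine ⟨n, by omega, n * n + 1, by omega, rfl, fun p _ hp => ?_, ?_, ?_, htab _ a ha hA,
    htab _ b hb hB, ?_⟩
  · rw [hleft p (by omega), getElem?_encodeGraph_of_lt G hp]
    rfl
  · rw [hleft n (by omega), getElem?_encodeGraph_self G]
    rfl
  · exact (getElem?_encodePair_eq_none _ _ _).2 hx.symm
  · refine (tableLayout_iff (by omega) hA hB
      (fun k => by have := ha k; have := hD k; omega)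
      (fun k => by have := hb k; have := hD k; omega) (sideLength_pos grid)).2
      ⟨h.1, fun u v => Iff.trans ?_ (h.2 u v)⟩
    classical
    have hlt : (u : ℕ) * n + v < n * n := calc
      (u : ℕ) * n + v < (u + 1) * n := by rw [Nat.succ_mul]; exact Nat.add_lt_add_left v.2 _
      _ ≤ n * n := Nat.mul_le_mul_right _ u.2
    rw [hleft _ (by omega), getElem?_encodeGraph_adj]
    simp

/-- If the graphs in a class are exactly those with a layout, and coordinates at most `n * n`
suffice for such a layout, then the recognition problem of the class is in NP: a certificate for a
graph with `n` vertices needs `2 * n * (n * n + 1)` bits, and the length of the instance is at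
least `n`. -/
theorem inNP_of_layout (grid : Bool) (𝒢 : ∀ n : ℕ, SimpleGraph (Fin n) → Prop)
    (h₁ : ∀ n G, 𝒢 n G → ∃ a b : Fin n → ℕ, (∀ k, a k ≤ n * n ∧ b k ≤ n * n) ∧
      IsLayout (sideLength grid n) a b G)
    (h₂ : ∀ n G (a b : Fin n → ℕ), IsLayout (sideLength grid n) a b G → 𝒢 n G) :
    InNP (recognitionProblem 𝒢) := by
  classical
  refine ⟨2 * (.X * (.X * .X + 1)), _,
    (Verifier.accepts grid).polyTime encodePair (Verifier.wellScoped_accepts grid), fun x => ?_⟩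
  simp only [decide_eq_true_iff, Verifier.holds_accepts]
  constructor
  · rintro ⟨n, G, hG, rfl⟩
    obtain ⟨a, b, hab, hl⟩ := h₁ n G hG
    refine ⟨certificate a b, ?_, accepts_certificate (fun k => (hab k).1) (fun k => (hab k).2) hl⟩
    have hle : n ≤ (encodeGraph G).length := by rw [length_encodeGraph]; omega
    simp only [length_certificate, Polynomial.eval_mul, Polynomial.eval_ofNat, Polynomial.eval_add,
      Polynomial.eval_X, Polynomial.eval_one]
    gcongr
  · rintro ⟨w, -, hw⟩
    obtain ⟨n, G, a, b, hl, rfl⟩ := exists_layout_of_accepts hw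
    exact ⟨n, G, h₂ n G a b hl, rfl⟩

theorem represents_of_isEmpty {V : Type*} [IsEmpty V] (p : V → ℝ × ℝ) (G : SimpleGraph V) :
    Represents p G :=
  ⟨fun u => isEmptyElim u, by ext u; exact isEmptyElim u⟩

theorem inNP_isUSV : InNP (recognitionProblem fun _ G => IsUSV G) := by
  refine inNP_of_layout false _ (fun n G h => ?_) fun n G a b h => ?_
  · obtain ⟨a, b, hab, hl⟩ := h.exists_layout
    simp only [Fintype.card_fin, sq] at hab hl
    exact ⟨a, b, hab, hl⟩
  · -- Without vertices, the side length is zero, but every layout is empty anyway.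
    rcases Nat.eq_zero_or_pos n with rfl | hn
    · exact ⟨fun _ => 0, represents_of_isEmpty _ _⟩
    · exact ⟨_, (isLayout_nat_iff n hn a b G).1 h⟩

theorem inNP_isUSGV : InNP (recognitionProblem fun _ G => IsUSGV G) := by
  refine inNP_of_layout true _ (fun n G h => ?_) fun n G a b h => ?_
  · obtain ⟨a, b, hab, hl⟩ := h.exists_layout
    simp only [Fintype.card_fin] at hab
    have hle : 2 * (n - 1) ≤ n * n := by
      rcases n with _ | n
      · simp
      · simp only [Nat.add_sub_cancel]
        nlinarith
    exact ⟨a, b, fun k => ⟨(hab k).1.trans hle, (hab k).2.trans hle⟩, hl⟩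
  · exact ⟨fun v => (a v, b v), (isLayout_one_iff (fun v => (a v, b v)) G).1 h⟩

end UnitSquareVisibility

theorem mainTheorem3 :
    UnitSquareVisibility.InNP
      (UnitSquareVisibility.recognitionProblem fun _ G => UnitSquareVisibility.IsUSV G) ∧
    (∀ (V : Type*) [Fintype V] (G : SimpleGraph V), UnitSquareVisibility.IsUSV G →
      ∃ a b : V → ℕ,
        (∀ v, a v ≤ Fintype.card V ^ 2 ∧ b v ≤ Fintype.card V ^ 2) ∧
        UnitSquareVisibility.Represents
          (fun v => ((a v : ℝ) / (Fintype.card V : ℝ), (b v : ℝ) / (Fintype.card V : ℝ))) G) ∧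
    UnitSquareVisibility.InNP
      (UnitSquareVisibility.recognitionProblem fun _ G => UnitSquareVisibility.IsUSGV G) ∧
    (∀ (V : Type*) [Fintype V] (G : SimpleGraph V), UnitSquareVisibility.IsUSGV G →
      ∃ q : V → ℕ × ℕ,
        (∀ v, (q v).1 ≤ 2 * Fintype.card V - 1 ∧ (q v).2 ≤ 2 * Fintype.card V - 1) ∧
        UnitSquareVisibility.Represents
          (fun v => UnitSquareVisibility.gridPosition (q v)) G) := by
  refine ⟨UnitSquareVisibility.inNP_isUSV, fun V _ G h => ?_,
    UnitSquareVisibility.inNP_isUSGV, fun V _ G h => ?_⟩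
  · obtain ⟨a, b, hab, hl⟩ := h.exists_layout
    refine ⟨a, b, hab, ?_⟩
    rcases isEmpty_or_nonempty V with hV | hV
    · exact UnitSquareVisibility.represents_of_isEmpty _ _
    · exact (UnitSquareVisibility.isLayout_nat_iff _ Fintype.card_pos a b G).1 hl
  · obtain ⟨a, b, hab, hl⟩ := h.exists_layout
    refine ⟨fun v => (a v, b v), fun v => ?_,
      (UnitSquareVisibility.isLayout_one_iff (fun v => (a v, b v)) G).1 hl⟩
    have := hab v
    dsimp only
    omega
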